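/- Assume the Continuum Hypothesis, $\aleph_1 = 2^{\aleph_0}$. Let $H$ be a separable complex Hilbert space and let $\mathcal N$ be a nest on $H$, that is, a set of orthogonal projections on $H$ (identified with their ranges) which is linearly ordered, contains $0$ and $I$, and is order-complete (closed under arbitrary intersections and closed linear spans of the ranges). Let $\mathcal T(\mathcal N)$ be the nest algebra, i.e. the algebra of all bounded operators on $H$ that leave the range of every $N\in\mathcal N$ invariant. For $X\in\mathcal T(\mathcal N)$ put $$i_N^+(X) = \inf\{\|(M-N)X(M-N)\| : M\in\mathcal N,\ M>N\}\quad (N\in\mathcal N,\ N<I),$$ $$i_N^-(X) = \inf\{\|(N-M)X(N-M)\| : M\in\mathcal N,\ M<N\}\quad (N\in\mathcal N,\ N>0).$$ The diagonal ideals of $\mathcal T(\mathcal N)$ are the two-sided ideals $\mathcal I_N^{+}=\{X\in\mathcal T(\mathcal N): i_N^{+}(X)=0\}$ for $N\in\mathcal N$, $N<I$, and $\mathcal I_N^{-}=\{X\in\mathcal T(\mathcal N): i_N^{-}(X)=0\}$ for $N\in\mathcal N$, $N>0$. Then every diagonal ideal of $\mathcal T(\mathcal N)$ is a left primitive ideal,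 i.e. the annihilator of a simple left $\mathcal T(\mathcal N)$-module. Moreover, the Jacobson radical of $\mathcal T(\mathcal N)$ is the intersection of the diagonal ideals of $\mathcal T(\mathcal N)$ (for $H=0$ the empty intersection is understood to be the whole algebra). -/

import Mathlib

universe u

noncomputable section

/-- A left primitive ideal of a unital ring `R`: the annihilator of a simple left `R`-module. -/
def IsLeftPrimitiveIdeal {R : Type u} [Ring R] (P : Ideal R) : Prop :=
  ∃ (V : Type u) (_ : AddCommGroup V) (_ : Module R V),
    IsSimpleModule R V ∧ P = Module.annihilator R V

/-- A nest on `H`: a set of closed subspaces (the ranges of the projections of the nest) that is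
linearly ordered by inclusion, contains `0` and `H`, and is order-complete, i.e. closed under
arbitrary intersections and closed linear spans. -/
structure HilbertNest (H : Type u) [NormedAddCommGroup H] [InnerProductSpace ℂ H] where
  carrier : Set (ClosedSubmodule ℂ H)
  chain : IsChain (· ≤ ·) carrier
  bot_mem : ⊥ ∈ carrier
  top_mem : ⊤ ∈ carrier
  sInf_mem : ∀ S ⊆ carrier, sInf S ∈ carrier
  sSup_mem : ∀ S ⊆ carrier, sSup S ∈ carrier

namespace HilbertNest

variable {H : Type u} [NormedAddCommGroup H] [InnerProductSpace ℂ H]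

/-- The nest algebra: the bounded operators leaving every subspace of the nest invariant. -/
def algebra (𝒩 : HilbertNest H) : Subalgebra ℂ (H →L[ℂ] H) where
  carrier := {X | ∀ N ∈ 𝒩.carrier, ∀ x ∈ N, X x ∈ N}
  mul_mem' := fun {X Y} hX hY N hN x hx => hX N hN (Y x) (hY N hN x hx)
  add_mem' := fun {X Y} hX hY N hN x hx => add_mem (hX N hN x hx) (hY N hN x hx)
  algebraMap_mem' := fun c N _ x hx => by
    have h : (algebraMap ℂ (H →L[ℂ] H) c) x = c • x := by
      simp [Algebra.algebraMap_eq_smul_one]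
    rw [h]
    exact N.toSubmodule.smul_mem c hx

variable [CompleteSpace H]

/-- The difference `B - A` of the orthogonal projections onto `B` and `A`. -/
def intervalProj (A B : ClosedSubmodule ℂ H) : H →L[ℂ] H :=
  B.toSubmodule.starProjection - A.toSubmodule.starProjection

/-- The compression `(B - A) X (B - A)`. -/
def compress (A B : ClosedSubmodule ℂ H) (X : H →L[ℂ] H) : H →L[ℂ] H :=
  intervalProj A B * X * intervalProj A B

/-- The diagonal seminorm `i⁺_N(X) = inf {‖(M - N) X (M - N)‖ : M > N in the nest}`
(used for `N < ⊤` only). -/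
def upperSeminorm (𝒩 : HilbertNest H) (N : ClosedSubmodule ℂ H) (X : H →L[ℂ] H) : ℝ :=
  ⨅ M : {M : ClosedSubmodule ℂ H // M ∈ 𝒩.carrier ∧ N < M}, ‖compress N M.1 X‖

/-- The diagonal seminorm `i⁻_N(X) = inf {‖(N - M) X (N - M)‖ : M < N in the nest}`
(used for `N > ⊥` only). -/
def lowerSeminorm (𝒩 : HilbertNest H) (N : ClosedSubmodule ℂ H) (X : H →L[ℂ] H) : ℝ :=
  ⨅ M : {M : ClosedSubmodule ℂ H // M ∈ 𝒩.carrier ∧ M < N}, ‖compress M.1 N X‖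

section helpers

lemma proj_mul_of_le {A B : ClosedSubmodule ℂ H} (h : A ≤ B) :
    A.toSubmodule.starProjection * B.toSubmodule.starProjection =
      A.toSubmodule.starProjection :=
  Submodule.starProjection_comp_starProjection_of_le h

lemma mul_proj_of_le {A B : ClosedSubmodule ℂ H} (h : A ≤ B) :
    B.toSubmodule.starProjection * A.toSubmodule.starProjection =
      A.toSubmodule.starProjection := by
  ext x
  exact Submodule.starProjection_eq_self_iff.2 (h (Submodule.starProjection_apply_mem _ x))

lemma proj_mul_self (A : ClosedSubmodule ℂ H) :
    A.toSubmodule.starProjection * A.toSubmodule.starProjection =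
      A.toSubmodule.starProjection := proj_mul_of_le le_rfl

lemma intervalProj_norm_le {A B : ClosedSubmodule ℂ H} (h : A ≤ B) :
    ‖intervalProj A B‖ ≤ 1 := by
  have e : intervalProj A B = B.toSubmodule.starProjection * Aᗮ.toSubmodule.starProjection := by
    have h1 : Aᗮ.toSubmodule.starProjection = 1 - A.toSubmodule.starProjection :=
      Submodule.starProjection_orthogonal' A.toSubmodule
    rw [h1, mul_sub, mul_one, mul_proj_of_le h, intervalProj]
  rw [e]
  calc _ ≤ ‖B.toSubmodule.starProjection‖ * ‖Aᗮ.toSubmodule.starProjection‖ := norm_mul_le _ _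
    _ ≤ 1 * 1 := mul_le_mul (Submodule.starProjection_norm_le _)
        (Submodule.starProjection_norm_le _) (norm_nonneg _) zero_le_one
    _ = 1 := one_mul 1

lemma norm_compress_mono {A A' B B' : ClosedSubmodule ℂ H} (h1 : A ≤ A') (h2 : A' ≤ B')
    (h3 : B' ≤ B) (X : H →L[ℂ] H) : ‖compress A' B' X‖ ≤ ‖compress A B X‖ := by
  have l : intervalProj A' B' * intervalProj A B = intervalProj A' B' := by
    simp only [intervalProj, sub_mul, mul_sub, proj_mul_of_le h3, proj_mul_of_le (h2.trans h3),
      mul_proj_of_le (h1.trans h2), mul_proj_of_le h1]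
    abel
  have r : intervalProj A B * intervalProj A' B' = intervalProj A' B' := by
    simp only [intervalProj, sub_mul, mul_sub, mul_proj_of_le h3, mul_proj_of_le (h2.trans h3),
      proj_mul_of_le (h1.trans h2), proj_mul_of_le h1]
    abel
  have e : compress A' B' X = intervalProj A' B' * compress A B X * intervalProj A' B' := by
    calc compress A' B' X
        = (intervalProj A' B' * intervalProj A B) * X *
            (intervalProj A B * intervalProj A' B') := by rw [l, r, compress]
      _ = _ := by simp only [compress, mul_assoc]
  have n := intervalProj_norm_le h2
  rw [e]
  calc _ ≤ ‖intervalProj A' B'‖ * ‖compress A B X‖ * ‖intervalProj A' B'‖ := norm_mul₃_le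
    _ ≤ 1 * ‖compress A B X‖ * 1 := by gcongr
    _ = _ := by ring

lemma compress_add (A B : ClosedSubmodule ℂ H) (X Y : H →L[ℂ] H) :
    compress A B (X + Y) = compress A B X + compress A B Y := by
  simp [compress, mul_add, add_mul]

lemma compress_mul {𝒩 : HilbertNest H} {A B : ClosedSubmodule ℂ H} (hA : A ∈ 𝒩.carrier)
    (hB : B ∈ 𝒩.carrier) (h : A ≤ B) {X Y : H →L[ℂ] H} (hX : X ∈ 𝒩.algebra)
    (hY : Y ∈ 𝒩.algebra) :
    compress A B (X * Y) = intervalProj A B * X * intervalProj A B * Y * intervalProj A B := by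
  have hA0 : intervalProj A B * X * A.toSubmodule.starProjection = 0 := by
    ext x
    have m : X (A.toSubmodule.starProjection x) ∈ A :=
      hX A hA _ (Submodule.starProjection_apply_mem A.toSubmodule x)
    have e1 : A.toSubmodule.starProjection (X (A.toSubmodule.starProjection x)) =
      X (A.toSubmodule.starProjection x) := Submodule.starProjection_eq_self_iff.2 m
    have e2 : B.toSubmodule.starProjection (X (A.toSubmodule.starProjection x)) =
      X (A.toSubmodule.starProjection x) := Submodule.starProjection_eq_self_iff.2 (h m)
    simp [intervalProj, e1, e2]
  have hBY : Y * intervalProj A B = B.toSubmodule.starProjection * (Y * intervalProj A B) := by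
    ext x
    have m : intervalProj A B x ∈ B :=
      B.toSubmodule.sub_mem (Submodule.starProjection_apply_mem B.toSubmodule x)
        (h (Submodule.starProjection_apply_mem A.toSubmodule x))
    exact (Submodule.starProjection_eq_self_iff.2 (hY B hB _ m)).symm
  have hs : B.toSubmodule.starProjection = intervalProj A B + A.toSubmodule.starProjection := by
    simp [intervalProj]
  calc compress A B (X * Y) = intervalProj A B * X * (Y * intervalProj A B) := by
        simp only [compress, mul_assoc]
    _ = intervalProj A B * X * (B.toSubmodule.starProjection * (Y * intervalProj A B)) := by
        rw [← hBY]
    _ = intervalProj A B * X * intervalProj A B * (Y * intervalProj A B) +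
          (intervalProj A B * X * A.toSubmodule.starProjection) * (Y * intervalProj A B) := by
        rw [hs]
        simp only [mul_add, add_mul, mul_assoc]
    _ = _ := by rw [hA0, zero_mul, add_zero]; simp only [mul_assoc]

lemma norm_compress_mul_le {𝒩 : HilbertNest H} {A B : ClosedSubmodule ℂ H} (hA : A ∈ 𝒩.carrier)
    (hB : B ∈ 𝒩.carrier) (h : A ≤ B) {X Y : H →L[ℂ] H} (hX : X ∈ 𝒩.algebra)
    (hY : Y ∈ 𝒩.algebra) :
    ‖compress A B (X * Y)‖ ≤ ‖X‖ * ‖compress A B Y‖ ∧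
      ‖compress A B (X * Y)‖ ≤ ‖compress A B X‖ * ‖Y‖ := by
  have n := intervalProj_norm_le h
  constructor
  · calc ‖compress A B (X * Y)‖ = ‖intervalProj A B * X * compress A B Y‖ := by
          rw [compress_mul hA hB h hX hY]; simp only [compress, mul_assoc]
      _ ≤ ‖intervalProj A B‖ * ‖X‖ * ‖compress A B Y‖ :=
          (norm_mul_le _ _).trans (by gcongr; exact norm_mul_le _ _)
      _ ≤ 1 * ‖X‖ * ‖compress A B Y‖ := by gcongr
      _ = _ := by rw [one_mul]
  · calc ‖compress A B (X * Y)‖ = ‖compress A B X * (Y * intervalProj A B)‖ := by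
          rw [compress_mul hA hB h hX hY]; simp only [compress, mul_assoc]
      _ ≤ ‖compress A B X‖ * (‖Y‖ * ‖intervalProj A B‖) :=
          (norm_mul_le _ _).trans (by gcongr; exact norm_mul_le _ _)
      _ ≤ ‖compress A B X‖ * (‖Y‖ * 1) := by gcongr
      _ = _ := by rw [mul_one]

lemma iInf_eq_zero_iff {ι : Type*} [Nonempty ι] {f : ι → ℝ} (hf : ∀ i, 0 ≤ f i) :
    ⨅ i, f i = 0 ↔ ∀ ε > 0, ∃ i, f i < ε := by
  refine ⟨fun h ε hε => exists_lt_of_ciInf_lt (h ▸ hε), fun h => le_antisymm ?_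
    (Real.iInf_nonneg hf)⟩
  refine le_of_forall_pos_lt_add fun ε hε => ?_
  obtain ⟨i, hi⟩ := h ε hε
  rw [zero_add]
  exact (ciInf_le ⟨0, by rintro _ ⟨j, rfl⟩; exact hf j⟩ i).trans_lt hi

lemma upperSeminorm_eq_zero_iff (𝒩 : HilbertNest H) {N : ClosedSubmodule ℂ H} (hlt : N < ⊤)
    (X : H →L[ℂ] H) : 𝒩.upperSeminorm N X = 0 ↔
      ∀ ε > 0, ∃ M ∈ 𝒩.carrier, N < M ∧ ‖compress N M X‖ < ε := by
  have : Nonempty {M : ClosedSubmodule ℂ H // M ∈ 𝒩.carrier ∧ N < M} := ⟨⟨⊤, 𝒩.top_mem, hlt⟩⟩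
  rw [upperSeminorm, iInf_eq_zero_iff fun _ => norm_nonneg _]
  simp [and_assoc]

lemma upperSeminorm_mul (𝒩 : HilbertNest H) {N : ClosedSubmodule ℂ H} (hN : N ∈ 𝒩.carrier)
    (hlt : N < ⊤) {X Y : H →L[ℂ] H} (hX : X ∈ 𝒩.algebra) (hY : Y ∈ 𝒩.algebra)
    (h : 𝒩.upperSeminorm N X = 0 ∨ 𝒩.upperSeminorm N Y = 0) :
    𝒩.upperSeminorm N (X * Y) = 0 := by
  simp only [𝒩.upperSeminorm_eq_zero_iff hlt] at h ⊢
  intro ε hε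
  rcases h with h | h
  · obtain ⟨M, hM, hNM, hl⟩ := h (ε / (‖Y‖ + 1)) (by positivity)
    refine ⟨M, hM, hNM, ?_⟩
    have b := (norm_compress_mul_le hN hM hNM.le hX hY).2
    rw [lt_div_iff₀ (by positivity)] at hl
    nlinarith [norm_nonneg (compress N M X)]
  · obtain ⟨M, hM, hNM, hl⟩ := h (ε / (‖X‖ + 1)) (by positivity)
    refine ⟨M, hM, hNM, ?_⟩
    have b := (norm_compress_mul_le hN hM hNM.le hX hY).1
    rw [lt_div_iff₀ (by positivity)] at hl
    nlinarith [norm_nonneg (compress N M Y)]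

lemma upperSeminorm_add (𝒩 : HilbertNest H) {N : ClosedSubmodule ℂ H} (hlt : N < ⊤)
    {X Y : H →L[ℂ] H} (hX : 𝒩.upperSeminorm N X = 0) (hY : 𝒩.upperSeminorm N Y = 0) :
    𝒩.upperSeminorm N (X + Y) = 0 := by
  simp only [𝒩.upperSeminorm_eq_zero_iff hlt] at hX hY ⊢
  intro ε hε
  obtain ⟨M, hM, hNM, hl⟩ := hX (ε / 2) (by positivity)
  obtain ⟨M', hM', hNM', hl'⟩ := hY (ε / 2) (by positivity)
  have key : ∀ L, N < L → L ≤ M → L ≤ M' → ‖compress N L (X + Y)‖ < ε := by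
    intro L h h1 h2
    have a1 := norm_compress_mono le_rfl h.le h1 X
    have a2 := norm_compress_mono le_rfl h.le h2 Y
    have a3 := norm_add_le (compress N L X) (compress N L Y)
    rw [compress_add]
    linarith
  rcases 𝒩.chain.total hM hM' with h | h
  · exact ⟨M, hM, hNM, key M hNM le_rfl h⟩
  · exact ⟨M', hM', hNM', key M' hNM' h le_rfl⟩

lemma lowerSeminorm_eq_zero_iff (𝒩 : HilbertNest H) {N : ClosedSubmodule ℂ H} (hlt : ⊥ < N)
    (X : H →L[ℂ] H) : 𝒩.lowerSeminorm N X = 0 ↔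
      ∀ ε > 0, ∃ M ∈ 𝒩.carrier, M < N ∧ ‖compress M N X‖ < ε := by
  have : Nonempty {M : ClosedSubmodule ℂ H // M ∈ 𝒩.carrier ∧ M < N} := ⟨⟨⊥, 𝒩.bot_mem, hlt⟩⟩
  rw [lowerSeminorm, iInf_eq_zero_iff fun _ => norm_nonneg _]
  simp [and_assoc]

lemma lowerSeminorm_mul (𝒩 : HilbertNest H) {N : ClosedSubmodule ℂ H} (hN : N ∈ 𝒩.carrier)
    (hlt : ⊥ < N) {X Y : H →L[ℂ] H} (hX : X ∈ 𝒩.algebra) (hY : Y ∈ 𝒩.algebra)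
    (h : 𝒩.lowerSeminorm N X = 0 ∨ 𝒩.lowerSeminorm N Y = 0) :
    𝒩.lowerSeminorm N (X * Y) = 0 := by
  simp only [𝒩.lowerSeminorm_eq_zero_iff hlt] at h ⊢
  intro ε hε
  rcases h with h | h
  · obtain ⟨M, hM, hNM, hl⟩ := h (ε / (‖Y‖ + 1)) (by positivity)
    refine ⟨M, hM, hNM, ?_⟩
    have b := (norm_compress_mul_le hM hN hNM.le hX hY).2
    rw [lt_div_iff₀ (by positivity)] at hl
    nlinarith [norm_nonneg (compress M N X)]
  · obtain ⟨M, hM, hNM, hl⟩ := h (ε / (‖X‖ + 1)) (by positivity)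
    refine ⟨M, hM, hNM, ?_⟩
    have b := (norm_compress_mul_le hM hN hNM.le hX hY).1
    rw [lt_div_iff₀ (by positivity)] at hl
    nlinarith [norm_nonneg (compress M N Y)]

lemma lowerSeminorm_add (𝒩 : HilbertNest H) {N : ClosedSubmodule ℂ H} (hlt : ⊥ < N)
    {X Y : H →L[ℂ] H} (hX : 𝒩.lowerSeminorm N X = 0) (hY : 𝒩.lowerSeminorm N Y = 0) :
    𝒩.lowerSeminorm N (X + Y) = 0 := by
  simp only [𝒩.lowerSeminorm_eq_zero_iff hlt] at hX hY ⊢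
  intro ε hε
  obtain ⟨M, hM, hNM, hl⟩ := hX (ε / 2) (by positivity)
  obtain ⟨M', hM', hNM', hl'⟩ := hY (ε / 2) (by positivity)
  have key : ∀ L, L < N → M ≤ L → M' ≤ L → ‖compress L N (X + Y)‖ < ε := by
    intro L h h1 h2
    have a1 := norm_compress_mono h1 h.le le_rfl X
    have a2 := norm_compress_mono h2 h.le le_rfl Y
    have a3 := norm_add_le (compress L N X) (compress L N Y)
    rw [compress_add]
    linarith
  rcases 𝒩.chain.total hM hM' with h | h
  · exact ⟨M', hM', hNM', key M' hNM' h le_rfl⟩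
  · exact ⟨M, hM, hNM, key M hNM le_rfl h⟩

end helpers

/-- The diagonal ideal `I⁺_N = {X : i⁺_N(X) = 0}` of the nest algebra, for `N` in the nest with
`N < ⊤`. -/
def upperIdeal (𝒩 : HilbertNest H) (N : ClosedSubmodule ℂ H) (hN : N ∈ 𝒩.carrier)
    (hlt : N < ⊤) : Ideal 𝒩.algebra where
  carrier := {X | 𝒩.upperSeminorm N (X : H →L[ℂ] H) = 0}
  zero_mem' := by
    simp [upperSeminorm, compress]
  add_mem' := fun hX hY => 𝒩.upperSeminorm_add hlt hX hY
  smul_mem' := fun A X hX => 𝒩.upperSeminorm_mul hN hlt A.2 X.2 (Or.inr hX)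

lemma upperIdeal_isTwoSided (𝒩 : HilbertNest H) (N : ClosedSubmodule ℂ H)
    (hN : N ∈ 𝒩.carrier) (hlt : N < ⊤) : (𝒩.upperIdeal N hN hlt).IsTwoSided :=
  ⟨fun {X} A hX => 𝒩.upperSeminorm_mul hN hlt X.2 A.2 (Or.inl hX)⟩

/-- The diagonal ideal `I⁻_N = {X : i⁻_N(X) = 0}` of the nest algebra, for `N` in the nest with
`⊥ < N`. -/
def lowerIdeal (𝒩 : HilbertNest H) (N : ClosedSubmodule ℂ H) (hN : N ∈ 𝒩.carrier)
    (hlt : ⊥ < N) : Ideal 𝒩.algebra where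
  carrier := {X | 𝒩.lowerSeminorm N (X : H →L[ℂ] H) = 0}
  zero_mem' := by
    simp [lowerSeminorm, compress]
  add_mem' := fun hX hY => 𝒩.lowerSeminorm_add hlt hX hY
  smul_mem' := fun A X hX => 𝒩.lowerSeminorm_mul hN hlt A.2 X.2 (Or.inr hX)

lemma lowerIdeal_isTwoSided (𝒩 : HilbertNest H) (N : ClosedSubmodule ℂ H)
    (hN : N ∈ 𝒩.carrier) (hlt : ⊥ < N) : (𝒩.lowerIdeal N hN hlt).IsTwoSided :=
  ⟨fun {X} A hX => 𝒩.lowerSeminorm_mul hN hlt X.2 A.2 (Or.inl hX)⟩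

/-- The diagonal ideals of the nest algebra: all `I⁺_N` with `N < ⊤` and all `I⁻_N` with `N > ⊥`,
where `N` ranges over the nest. -/
def IsDiagonalIdeal (𝒩 : HilbertNest H) (I : Ideal 𝒩.algebra) : Prop :=
  (∃ (N : ClosedSubmodule ℂ H) (hN : N ∈ 𝒩.carrier) (hlt : N < ⊤), I = 𝒩.upperIdeal N hN hlt) ∨
    ∃ (N : ClosedSubmodule ℂ H) (hN : N ∈ 𝒩.carrier) (hlt : ⊥ < N), I = 𝒩.lowerIdeal N hN hlt

end HilbertNest

end

/-! A two-sided ideal `I` is left primitive once some proper left ideal `L` above `I` contains, for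
every `X ∉ I`, an element `1 - B * X * A`: then `X` cannot annihilate the quotient by a maximal left
ideal above `L`. The work lies in finding `L`.

If the nest has a gap at `N` on the relevant side, the diagonal ideal is the kernel of the
compression to an atom, and rank-one operators together with a single vector give `L`
(`isLeftPrimitiveIdeal_of_gap`). Otherwise the intervals next to `N` give projections `E i`
decreasing strongly to `0`, and `X` is outside `I` iff the norms of `E i * X * E i` are bounded away
from `0`. Now `L` is the sum of `I` and the operators tending to `0` along a filter of unit vectors
which eventually lie in the range of each `E i`. Under CH there are at most `ℵ₁` operators `X` to
treat, so they can be handled one at a time, with only countably many operators already required to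
vanish at each stage (`exists_set_of_countable_extension`).

One stage is `exists_vanishingFilter_insert_neBot`. In successive intervals, unit vectors `x n`,
then `z n` and `w n`, are chosen such that earlier operators almost kill `x n` and `⟪w n, X (z n)⟫`
stays away from `0`. Operators of the algebra move vectors in one direction along the nest only, so
`B * X * A` is made to shift the `x n` rather than to fix them. Normalized sums of long runs of the
`x n` are almost invariant under the shift, and earlier operators still almost kill them.

The radical lies in every primitive ideal. Conversely, for `X` in all diagonal ideals, the members
of the nest on which `1 - X` is left invertible include their supremum, which cannot be below `⊤`
(`exists_left_inverse_one_sub`). -/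

open Filter Topology Set

open scoped InnerProductSpace

/-! ### Primitive ideals and the radical in a general ring -/

section Ring

variable {R : Type u} [Ring R]

lemma isLeftPrimitiveIdeal_of_le {I L : Ideal R} [I.IsTwoSided] (hIL : I ≤ L) (hL : L ≠ ⊤)
    (h : ∀ x ∉ I, ∃ a b : R, 1 - b * x * a ∈ L) : IsLeftPrimitiveIdeal I := by
  obtain ⟨M, hM, hLM⟩ := Ideal.exists_le_maximal L hL
  refine ⟨R ⧸ M, inferInstance, inferInstance,
    isSimpleModule_iff_isCoatom.2 (Ideal.isMaximal_def.1 hM), ?_⟩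
  ext x
  rw [Module.mem_annihilator]
  constructor
  · intro hx v
    obtain ⟨y, rfl⟩ := Submodule.Quotient.mk_surjective M v
    rw [← Submodule.Quotient.mk_smul, Submodule.Quotient.mk_eq_zero]
    exact hLM (hIL (I.mul_mem_right y hx))
  · intro hx
    by_contra hxI
    obtain ⟨a, b, hab⟩ := h x hxI
    have h1 := hx (Submodule.Quotient.mk a)
    rw [← Submodule.Quotient.mk_smul, Submodule.Quotient.mk_eq_zero, smul_eq_mul] at h1
    have h2 : b * x * a ∈ M := by
      rw [mul_assoc]
      exact M.mul_mem_left b h1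
    refine hM.ne_top ((Ideal.eq_top_iff_one M).2 ?_)
    have := M.add_mem (hLM hab) h2
    rwa [sub_add_cancel] at this

lemma IsLeftPrimitiveIdeal.jacobson_le {I : Ideal R} (h : IsLeftPrimitiveIdeal I) :
    Ring.jacobson R ≤ I := by
  obtain ⟨V, _, _, hV, rfl⟩ := h
  exact IsSemisimpleModule.jacobson_le_annihilator R V

/-- If a maximal left ideal `M` does not contain `J`, then `1 = m + x` with `m ∈ M` and `x ∈ J`; a
left inverse of `m = 1 - x` forces `1 ∈ M`. -/
lemma le_jacobson_of_left_inverse {J : Ideal R} (h : ∀ x ∈ J, ∃ y : R, y * (1 - x) = 1) :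
    J ≤ Ring.jacobson R := by
  rw [Ring.jacobson_eq_sInf_isMaximal]
  refine le_sInf fun M (hM : M.IsMaximal) => ?_
  by_contra hJ
  have ht : M ⊔ J = ⊤ := by
    refine (Ideal.isMaximal_def.1 hM).2 _ (lt_of_le_of_ne le_sup_left fun he => hJ ?_)
    rw [he]
    exact le_sup_right
  obtain ⟨m, hm, x, hx, hmx⟩ := Submodule.mem_sup.1 (ht ▸ Submodule.mem_top : (1 : R) ∈ M ⊔ J)
  obtain ⟨y, hy⟩ := h x hx
  refine hM.ne_top ((Ideal.eq_top_iff_one M).2 ?_)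
  rw [← hy, ← hmx, add_sub_cancel_right]
  exact M.mul_mem_left y hm

end Ring

/-! ### Recursion with countable initial segments -/

section Recursion

/-- The order is pulled back from the initial ordinal `ω₁`, whose proper initial segments are
countable. -/
lemma exists_linearOrder_countable_Iio {α : Type u} (hα : Cardinal.mk α ≤ Cardinal.aleph 1) :
    ∃ (_ : LinearOrder α), WellFoundedLT α ∧ ∀ a : α, (Iio a).Countable := by
  have hle : Cardinal.mk α ≤ Cardinal.mk (Cardinal.aleph.{u} 1).ord.ToType := by
    rwa [Cardinal.mk_toType, Cardinal.card_ord]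
  obtain ⟨f⟩ := hle
  let _ : LinearOrder α := LinearOrder.lift' f f.injective
  refine ⟨inferInstance, ⟨InvImage.wf f wellFounded_lt⟩, fun a => ?_⟩
  have h : (Iio (f a)).Countable := by
    rw [← Cardinal.le_aleph0_iff_set_countable]
    have h1 := Cardinal.mk_Iio_lt (f a) (by simp)
    rw [Cardinal.mk_toType, Cardinal.card_ord] at h1
    exact Order.lt_succ_iff.1 (h1.trans_eq Cardinal.succ_aleph0.symm)
  exact (h.preimage f.injective).mono fun b hb => hb

/-- Transfinite recursion of length `ω₁` along a property of finite character. -/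
lemma exists_set_of_countable_extension {α β : Type u} (hα : Cardinal.mk α ≤ Cardinal.aleph 1)
    {Q : Set β → Prop} {R : α → β → Prop}
    (hmono : ∀ S T : Set β, S ⊆ T → Q T → Q S) (hempty : Q ∅)
    (hfin : ∀ S : Set β, (∀ F ⊆ S, F.Finite → Q F) → Q S)
    (hstep : ∀ S : Set β, S.Countable → Q S → ∀ a, ∃ b, R a b ∧ Q (insert b S)) :
    ∃ S, Q S ∧ ∀ a, ∃ b ∈ S, R a b := by
  classical
  obtain ⟨_, hwf, hcount⟩ := exists_linearOrder_countable_Iio hα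
  by_cases hα0 : IsEmpty α
  · exact ⟨∅, hempty, fun a => hα0.elim a⟩
  have hβ : Nonempty β := by
    obtain ⟨a⟩ := not_isEmpty_iff.1 hα0
    exact ⟨(hstep ∅ countable_empty hempty a).choose⟩
  -- The choice is made total, with arbitrary values elsewhere, so that the recursion can be defined
  -- before its stages are known to satisfy `Q`.
  have hstep' : ∀ S : Set β, ∀ a, ∃ b, S.Countable → Q S → R a b ∧ Q (insert b S) := by
    intro S a
    by_cases h : S.Countable ∧ Q S
    · obtain ⟨b, hb⟩ := hstep S h.1 h.2 a
      exact ⟨b, fun _ _ => hb⟩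
    · exact ⟨Classical.arbitrary β, fun h1 h2 => (h ⟨h1, h2⟩).elim⟩
  choose φ hφ using hstep'
  let g : α → β := hwf.wf.fix fun a ih => φ {b | ∃ (c : α) (h : c < a), ih c h = b} a
  have hg : ∀ a, g a = φ (g '' Iio a) a := by
    intro a
    have := hwf.wf.fix_eq (fun a ih => φ {b | ∃ (c : α) (h : c < a), ih c h = b} a) a
    refine this.trans ?_
    congr 1
    ext b
    simp [g]
  -- A nonempty finite set of indices has a largest one `a`, so its image lies in the stage just
  -- after `a`. Finite character thus takes care of limit stages.
  have hinit : ∀ D : Set α, (∀ a ∈ D, Q (insert (g a) (g '' Iio a))) → Q (g '' D) := by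
    intro D hD
    refine hfin _ fun F hF hFf => ?_
    obtain ⟨F', hF'D, hF'f, rfl⟩ := exists_subset_image_finite_and.1 ⟨F, hF, hFf, rfl⟩
    rcases F'.eq_empty_or_nonempty with rfl | hne
    · simpa using hempty
    · obtain ⟨a, ha, hmax⟩ := hF'f.exists_maximalFor id F' hne
      refine hmono _ _ ?_ (hD a (hF'D ha))
      rintro _ ⟨c, hc, rfl⟩
      rcases lt_or_ge c a with h | h
      · exact mem_insert_of_mem _ ⟨c, h, rfl⟩
      · have : c = a := le_antisymm (hmax hc h) h
        rw [this]
        exact mem_insert _ _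
  have hQ : ∀ a, Q (g '' Iio a) := by
    intro a
    induction a using hwf.wf.induction with
    | _ a ih =>
      refine hinit _ fun c hc => ?_
      rw [hg c]
      exact (hφ _ c ((hcount c).image g) (ih c hc)).2
  have hR : ∀ a, R a (g a) ∧ Q (insert (g a) (g '' Iio a)) := by
    intro a
    rw [hg a]
    exact hφ _ a ((hcount a).image g) (hQ a)
  exact ⟨g '' univ, hinit _ fun a _ => (hR a).2, fun a => ⟨g a, ⟨a, trivial, rfl⟩, (hR a).1⟩⟩

end Recursion

/-! ### The number of bounded operators -/

section Cardinality

open Cardinal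

/-- By continuity, an operator is determined by which rational balls around points of a dense
sequence contain the images of that sequence. -/
lemma mk_continuousLinearMap_le_continuum {H : Type u} [NormedAddCommGroup H] [NormedSpace ℂ H]
    [TopologicalSpace.SeparableSpace H] : #(H →L[ℂ] H) ≤ 𝔠 := by
  let d := TopologicalSpace.denseSeq H
  have hd : DenseRange d := TopologicalSpace.denseRange_denseSeq H
  let f : (H →L[ℂ] H) → Set (ℕ × ℕ × ℚ) := fun T => {p | dist (T (d p.1)) (d p.2.1) < p.2.2}
  have hf : Function.Injective f := by
    intro S T hST
    refine ContinuousLinearMap.coeFn_injective (hd.equalizer S.continuous T.continuous ?_)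
    funext n
    by_contra hne
    have hpos : 0 < dist (S (d n)) (T (d n)) / 2 := half_pos (dist_pos.2 hne)
    obtain ⟨q, hq0, hq⟩ := exists_rat_btwn hpos
    obtain ⟨m, hm⟩ := hd.exists_dist_lt (S (d n)) hq0
    have h1 : (n, m, q) ∈ f S := hm
    rw [hST] at h1
    have h2 : dist (T (d n)) (d m) < q := h1
    have := dist_triangle_right (S (d n)) (T (d n)) (d m)
    linarith
  have := Cardinal.lift_mk_le_lift_mk_of_injective hf
  simpa using this

end Cardinality

/-! ### Operators between orthonormal sequences, and block means -/

section OrthonormalSequences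

variable {H : Type u} [NormedAddCommGroup H] [InnerProductSpace ℂ H]

/-- By Bessel's inequality the coefficients are in `ℓ²`, with norm at most `K * ‖y‖`; the sequence
`v` embeds `ℓ²` isometrically. -/
lemma Orthonormal.exists_clm_hasSum [CompleteSpace H] {u v : ℕ → H} (hu : Orthonormal ℂ u)
    (hv : Orthonormal ℂ v) {c : ℕ → ℂ} {K : ℝ} (hc : ∀ k, ‖c k‖ ≤ K) :
    ∃ C : H →L[ℂ] H, ∀ y, HasSum (fun k => (c k * ⟪u k, y⟫_ℂ) • v k) (C y) := by
  have hK : 0 ≤ K := (norm_nonneg _).trans (hc 0)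
  have hbound : ∀ (y : H) (s : Finset ℕ),
      ∑ k ∈ s, ‖c k * ⟪u k, y⟫_ℂ‖ ^ (2 : ENNReal).toReal ≤
        (K * ‖y‖) ^ (2 : ENNReal).toReal := by
    intro y s
    simp only [ENNReal.toReal_ofNat, Real.rpow_two, norm_mul, mul_pow]
    calc ∑ k ∈ s, ‖c k‖ ^ 2 * ‖⟪u k, y⟫_ℂ‖ ^ 2
        ≤ ∑ k ∈ s, K ^ 2 * ‖⟪u k, y⟫_ℂ‖ ^ 2 := by
          gcongr with k
          exact hc k
      _ = K ^ 2 * ∑ k ∈ s, ‖⟪u k, y⟫_ℂ‖ ^ 2 := by rw [Finset.mul_sum]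
      _ ≤ K ^ 2 * ‖y‖ ^ 2 := by
          gcongr
          exact hu.sum_inner_products_le y
  let D : H →ₗ[ℂ] lp (fun _ : ℕ => ℂ) 2 :=
    { toFun := fun y => ⟨fun k => c k * ⟪u k, y⟫_ℂ, memℓp_gen' (hbound y)⟩
      map_add' := fun y z => Subtype.ext <| funext fun k =>
        (by rw [inner_add_right, mul_add] :
          c k * ⟪u k, y + z⟫_ℂ = c k * ⟪u k, y⟫_ℂ + c k * ⟪u k, z⟫_ℂ)
      map_smul' := fun a y => Subtype.ext <| funext fun k =>
        (by rw [inner_smul_right, mul_left_comm] :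
          c k * ⟪u k, a • y⟫_ℂ = a * (c k * ⟪u k, y⟫_ℂ)) }
  let D' : H →L[ℂ] lp (fun _ : ℕ => ℂ) 2 := D.mkContinuous K fun y =>
    lp.norm_le_of_forall_sum_le (by simp) (by positivity) (hbound y)
  refine ⟨(hv.orthogonalFamily.linearIsometry.toContinuousLinearMap).comp D', fun y => ?_⟩
  have := hv.orthogonalFamily.hasSum_linearIsometry (D' y)
  exact this

/-- The normalized sum of `n + 1` consecutive terms, starting with the `n`-th. -/
noncomputable def blockMean (v : ℕ → H) (n : ℕ) : H :=
  ((Real.sqrt (n + 1))⁻¹ : ℝ) • ∑ j ∈ Finset.range (n + 1), v (n + j)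

lemma map_blockMean (D : H →L[ℂ] H) (v : ℕ → H) (n : ℕ) :
    D (blockMean v n) = blockMean (fun j => D (v j)) n := by
  simp [blockMean, ContinuousLinearMap.map_smul_of_tower]

lemma blockMean_sub (v w : ℕ → H) (n : ℕ) :
    blockMean (fun j => v j - w j) n = blockMean v n - blockMean w n := by
  simp [blockMean, Finset.sum_sub_distrib, smul_sub]

lemma tendsto_zero_of_norm_sum_le {v : ℕ → H} {K : ℝ}
    (h : ∀ᶠ n in atTop, ‖∑ j ∈ Finset.range (n + 1), v (n + j)‖ ≤ K) :
    Tendsto (blockMean v) atTop (𝓝 0) := by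
  have ht : Tendsto (fun n : ℕ => (Real.sqrt (n + 1))⁻¹ * K) atTop (𝓝 0) := by
    have : Tendsto (fun n : ℕ => (Real.sqrt (n + 1))⁻¹) atTop (𝓝 0) :=
      tendsto_inv_atTop_zero.comp (Real.tendsto_sqrt_atTop.comp
        (tendsto_atTop_add_const_right _ 1 tendsto_natCast_atTop_atTop))
    simpa using this.mul_const K
  refine squeeze_zero_norm' ?_ ht
  filter_upwards [h] with n hn
  rw [blockMean, norm_smul, Real.norm_of_nonneg (by positivity)]
  gcongr

lemma tendsto_blockMean_of_norm_le {v : ℕ → H} {K : ℝ}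
    (h : ∀ᶠ j in atTop, ‖v j‖ ≤ K * (1 / 2) ^ j) : Tendsto (blockMean v) atTop (𝓝 0) := by
  obtain ⟨l, hl⟩ := eventually_atTop.1 h
  have hK : 0 ≤ K := by
    have := (norm_nonneg _).trans (hl l le_rfl)
    exact nonneg_of_mul_nonneg_left this (by positivity)
  refine tendsto_zero_of_norm_sum_le (K := K * 2) ?_
  filter_upwards [eventually_ge_atTop l] with n hn
  calc ‖∑ j ∈ Finset.range (n + 1), v (n + j)‖
      ≤ ∑ j ∈ Finset.range (n + 1), K * (1 / 2) ^ j := by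
        refine norm_sum_le_of_le _ fun j _ => (hl (n + j) (by omega)).trans ?_
        gcongr K * ?_
        exact pow_le_pow_of_le_one (by norm_num) (by norm_num) (by omega)
    _ = K * ∑ j ∈ Finset.range (n + 1), (1 / 2 : ℝ) ^ j := by rw [Finset.mul_sum]
    _ ≤ K * 2 := by
        gcongr
        exact sum_geometric_two_le _

/-- The sum telescopes to a difference of two vectors of the unit ball, whatever the length of the
block, and the normalization tends to `0`. -/
lemma tendsto_blockMean_succ_sub {x : ℕ → H} (hx : ∀ j, ‖x j‖ ≤ 1) :
    Tendsto (blockMean fun j => x (j + 1) - x j) atTop (𝓝 0) := by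
  refine tendsto_zero_of_norm_sum_le (K := 1 + 1) (Eventually.of_forall fun n => ?_)
  have := Finset.sum_range_sub (fun j => x (n + j)) (n + 1)
  simp only [← add_assoc] at this ⊢
  rw [this]
  exact (norm_sub_le _ _).trans (add_le_add (hx _) (hx _))

lemma Orthonormal.norm_blockMean {x : ℕ → H} (hx : Orthonormal ℂ x) (n : ℕ) :
    ‖blockMean x n‖ = 1 := by
  have h1 : ‖∑ j ∈ Finset.range (n + 1), x (n + j)‖ ^ 2 = n + 1 := by
    have hx' : Orthonormal ℂ fun j => x (n + j) := hx.comp _ (add_right_injective n)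
    have := hx'.inner_sum (fun _ => (1 : ℂ)) (fun _ => 1) (Finset.range (n + 1))
    rw [inner_self_eq_norm_sq_to_K] at this
    simp only [one_smul, map_one, mul_one, Finset.sum_const, Finset.card_range] at this
    rw [nsmul_one] at this
    refine RCLike.ofReal_injective (K := ℂ) ?_
    push_cast at this ⊢
    exact this
  have h2 : ‖∑ j ∈ Finset.range (n + 1), x (n + j)‖ = Real.sqrt (n + 1) := by
    rw [← h1, Real.sqrt_sq (norm_nonneg _)]
  rw [blockMean, norm_smul, Real.norm_of_nonneg (by positivity), h2]
  exact inv_mul_cancel₀ (by positivity)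

/-- If `Y` almost acts as a shift, forwards or backwards, on an orthonormal sequence, then the
block means are asymptotically fixed by `Y`. -/
lemma tendsto_one_sub_blockMean {x : ℕ → H} (hx : ∀ j, ‖x j‖ ≤ 1) {Y : H →L[ℂ] H} {K : ℝ}
    {s t : ℕ → ℕ} (hst : (s = id ∧ t = Nat.succ) ∨ (s = Nat.succ ∧ t = id))
    (hY : ∀ j, ‖Y (x (s j)) - x (t j)‖ ≤ K * (1 / 2) ^ j) :
    Tendsto (fun n => (1 - Y) (blockMean (x ∘ s) n)) atTop (𝓝 0) := by
  have h1 := tendsto_blockMean_of_norm_le (v := fun j => Y (x (s j)) - x (t j))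
    (Eventually.of_forall hY)
  have h2 : Tendsto (blockMean fun j => x (t j) - x (s j)) atTop (𝓝 0) := by
    rcases hst with ⟨rfl, rfl⟩ | ⟨rfl, rfl⟩
    · exact tendsto_blockMean_succ_sub hx
    · have := (tendsto_blockMean_succ_sub hx).neg
      rw [neg_zero] at this
      refine this.congr fun n => ?_
      simp only [blockMean_sub]
      exact neg_sub _ _
  have h3 := (h1.add h2).neg
  rw [add_zero, neg_zero] at h3
  refine h3.congr fun n => ?_
  simp only [blockMean_sub, sub_apply, one_apply_eq_self,
    map_blockMean, Function.comp_def]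
  abel

end OrthonormalSequences

/-! ### The filter attached to a set of operators -/

section VanishingFilter

variable {H : Type u} [NormedAddCommGroup H] [InnerProductSpace ℂ H]
  {ι : Type u} {E : ι → H →L[ℂ] H}

/-- The filter of unit vectors in the ranges of the projections `E i` along which all operators
in `S` tend to `0`. -/
def vanishingFilter (E : ι → H →L[ℂ] H) (S : Set (H →L[ℂ] H)) : Filter H :=
  (⨅ i, 𝓟 {x | ‖x‖ = 1 ∧ E i x = x}) ⊓ ⨅ G ∈ S, comap (fun x => G x) (𝓝 0)

lemma vanishingFilter_anti {S T : Set (H →L[ℂ] H)} (h : S ⊆ T) :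
    vanishingFilter E T ≤ vanishingFilter E S :=
  inf_le_inf_left _ (biInf_mono h)

lemma eventually_vanishingFilter (S : Set (H →L[ℂ] H)) (i : ι) :
    ∀ᶠ x in vanishingFilter E S, ‖x‖ = 1 ∧ E i x = x :=
  mem_inf_of_left (mem_iInf_of_mem i (mem_principal_self _))

lemma tendsto_vanishingFilter {S : Set (H →L[ℂ] H)} {G : H →L[ℂ] H} (hG : G ∈ S) :
    Tendsto (fun x => G x) (vanishingFilter E S) (𝓝 0) :=
  tendsto_iff_comap.2 (inf_le_right.trans (iInf₂_le G hG))

lemma vanishingFilter_neBot_of_tendsto {S : Set (H →L[ℂ] H)} {x : ℕ → H} (h1 : ∀ n, ‖x n‖ = 1)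
    (h2 : ∀ i, ∀ᶠ n in atTop, E i (x n) = x n)
    (h3 : ∀ G ∈ S, Tendsto (fun n => G (x n)) atTop (𝓝 0)) : (vanishingFilter E S).NeBot := by
  have : Tendsto x atTop (vanishingFilter E S) := by
    refine tendsto_inf.2 ⟨tendsto_iInf.2 fun i => tendsto_principal.2 ?_,
      tendsto_iInf.2 fun G => tendsto_iInf.2 fun hG => tendsto_comap_iff.2 (h3 G hG)⟩
    exact (h2 i).mono fun n hn => ⟨h1 n, hn⟩
  exact this.neBot

/-- The filter is the directed infimum of those of the finite subsets, and a directed infimum of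
proper filters is proper. This is the finite character needed by the recursion. -/
lemma vanishingFilter_neBot_of_finite {S : Set (H →L[ℂ] H)}
    (h : ∀ F ⊆ S, F.Finite → (vanishingFilter E F).NeBot) : (vanishingFilter E S).NeBot := by
  classical
  have he : vanishingFilter E S =
      ⨅ F : Finset S, vanishingFilter E (Subtype.val '' (F : Set S)) := by
    refine le_antisymm (le_iInf fun F => vanishingFilter_anti (by rintro _ ⟨G, -, rfl⟩; exact G.2))
      (le_inf ((iInf_le _ ∅).trans inf_le_left) (le_iInf₂ fun G hG => ?_))
    refine (iInf_le _ {⟨G, hG⟩}).trans (inf_le_right.trans (iInf₂_le G ?_))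
    simp
  rw [he]
  refine iInf_neBot_of_directed' ?_ fun F => h _ ?_ (F.finite_toSet.image _)
  · intro F F'
    refine ⟨F ∪ F', vanishingFilter_anti (image_mono ?_), vanishingFilter_anti (image_mono ?_)⟩
    · simp
    · simp
  · rintro _ ⟨G, -, rfl⟩
    exact G.2

end VanishingFilter

/-! ### Nets of projections decreasing to zero -/

section DecreasingProjections

variable {H : Type u} [NormedAddCommGroup H] [InnerProductSpace ℂ H]
  {ι : Type u} [LinearOrder ι] {E : ι → H →L[ℂ] H}

/-- A decreasing net of orthogonal projections which converges strongly to `0`. -/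
structure IsVanishingProjectionNet (E : ι → H →L[ℂ] H) : Prop where
  symm : ∀ i x y, ⟪E i x, y⟫_ℂ = ⟪x, E i y⟫_ℂ
  apply_of_le : ∀ {i j}, i ≤ j → ∀ x, E i (E j x) = E j x
  tendsto : ∀ x, Tendsto (fun i => E i x) atTop (𝓝 0)

namespace IsVanishingProjectionNet

lemma apply_of_ge (hE : IsVanishingProjectionNet E) {i j : ι} (h : i ≤ j) (x : H) :
    E j (E i x) = E j x := by
  refine ext_inner_right ℂ fun y => ?_
  rw [hE.symm, hE.symm, hE.apply_of_le h, hE.symm]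

lemma norm_apply_le (hE : IsVanishingProjectionNet E) (i : ι) (x : H) : ‖E i x‖ ≤ ‖x‖ := by
  have h : ‖E i x‖ * ‖E i x‖ ≤ ‖x‖ * ‖E i x‖ := by
    have h1 : ⟪E i x, E i x⟫_ℂ = ⟪x, E i x⟫_ℂ := by rw [hE.symm, hE.apply_of_le le_rfl]
    have h2 := norm_inner_le_norm (𝕜 := ℂ) x (E i x)
    rwa [← h1, inner_self_eq_norm_sq_to_K, norm_pow, RCLike.norm_ofReal, abs_norm, sq] at h2
  rcases (norm_nonneg (E i x)).eq_or_lt with h0 | h0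
  · rw [← h0]
    exact norm_nonneg x
  · exact le_of_mul_le_mul_right h h0

lemma apply_eq_self_of_le (hE : IsVanishingProjectionNet E) {i j : ι} (h : i ≤ j) {x : H}
    (hx : E j x = x) : E i x = x := by
  rw [← hx, hE.apply_of_le h]

lemma inner_eq_zero (hE : IsVanishingProjectionNet E) {i : ι} {x y : H} (hx : E i x = 0)
    (hy : E i y = y) : ⟪x, y⟫_ℂ = 0 := by
  rw [← hy, ← hE.symm, hx, inner_zero_left]

end IsVanishingProjectionNet

/-- The part of `y` below the `j`-th projection removed, normalized. -/
noncomputable def truncation (E : ι → H →L[ℂ] H) (y : H) (j : ι) : H :=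
  (‖y - E j y‖⁻¹ : ℝ) • (y - E j y)

lemma IsVanishingProjectionNet.tendsto_truncation (hE : IsVanishingProjectionNet E) {y : H}
    (hy : ‖y‖ = 1) : Tendsto (truncation E y) atTop (𝓝 y) := by
  have h1 : Tendsto (fun j => y - E j y) atTop (𝓝 y) := by
    simpa using (tendsto_const_nhds (x := y)).sub (hE.tendsto y)
  have h2 := (h1.norm.inv₀ (by rw [hy]; exact one_ne_zero)).smul h1
  rwa [hy, inv_one, one_smul] at h2

/-- Cutting off `E j y` confines the vector to the range of `E i - E j`, at a small cost in norm for
large `j`. Vectors in disjoint intervals are orthogonal and can be separated by the nest. -/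
lemma IsVanishingProjectionNet.eventually_truncation (hE : IsVanishingProjectionNet E)
    {y : H} (hy : ‖y‖ = 1) {i : ι} (hi : E i y = y) :
    ∀ᶠ j in atTop, i ≤ j ∧ ‖truncation E y j‖ = 1 ∧ E i (truncation E y j) = truncation E y j ∧
      E j (truncation E y j) = 0 := by
  have h1 : Tendsto (fun j => ‖y - E j y‖) atTop (𝓝 1) := by
    simpa [hy] using ((tendsto_const_nhds (x := y)).sub (hE.tendsto y)).norm
  filter_upwards [eventually_ge_atTop i, h1.eventually_ne one_ne_zero] with j hj hne
  refine ⟨hj, ?_, ?_, ?_⟩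
  · rw [truncation, norm_smul, norm_inv, norm_norm, inv_mul_cancel₀ hne]
  · rw [truncation, ContinuousLinearMap.map_smul_of_tower, map_sub, hi, hE.apply_of_le hj]
  · rw [truncation, ContinuousLinearMap.map_smul_of_tower, map_sub, hE.apply_of_le le_rfl,
      sub_self, smul_zero]

lemma vanishingFilter_empty_neBot [Nonempty ι] (hE : IsVanishingProjectionNet E)
    (hne : ∀ i, E i ≠ 0) : (vanishingFilter E ∅).NeBot := by
  simp only [vanishingFilter, mem_empty_iff_false, iInf_false, iInf_top, inf_top_eq]
  refine iInf_neBot_of_directed' ?_ fun i => principal_neBot_iff.2 ?_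
  · intro i j
    refine ⟨max i j, principal_mono.2 ?_, principal_mono.2 ?_⟩ <;> rintro x ⟨h1, h2⟩
    · exact ⟨h1, hE.apply_eq_self_of_le (le_max_left i j) h2⟩
    · exact ⟨h1, hE.apply_eq_self_of_le (le_max_right i j) h2⟩
  · obtain ⟨y, hy⟩ : ∃ y, E i y ≠ 0 := by
      by_contra! h
      exact hne i (ContinuousLinearMap.ext h)
    refine ⟨(‖E i y‖⁻¹ : ℝ) • E i y, ?_, ?_⟩
    · rw [norm_smul, norm_inv, norm_norm, inv_mul_cancel₀ (norm_ne_zero_iff.2 hy)]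
    · rw [ContinuousLinearMap.map_smul_of_tower, hE.apply_of_le le_rfl]

/-- If `E i * X * E i` has norm greater than `δ`, then `X` has a matrix entry of modulus greater
than `δ` between unit vectors in the range of `E i`. -/
lemma IsVanishingProjectionNet.exists_inner_gt (hE : IsVanishingProjectionNet E)
    {X : H →L[ℂ] H} {δ : ℝ} (hδ : 0 < δ) {i : ι} (hX : δ < ‖E i * X * E i‖) :
    ∃ z w : H, ‖z‖ = 1 ∧ ‖w‖ = 1 ∧ E i z = z ∧ E i w = w ∧ δ < ‖⟪w, X z⟫_ℂ‖ := by
  obtain ⟨y, hy, hyX⟩ := ContinuousLinearMap.exists_lt_apply_of_lt_opNorm _ hX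
  set p := E i y with hp
  set v := E i (X p) with hv
  have hyX' : δ < ‖v‖ := hyX
  have hp1 : ‖p‖ ≤ 1 := (hE.norm_apply_le i y).trans hy.le
  have hv0 : ‖v‖ ≠ 0 := (hδ.trans hyX').ne'
  have hp0 : ‖p‖ ≠ 0 := by
    intro h
    have : p = 0 := norm_eq_zero.1 h
    rw [hv, this, map_zero, map_zero, norm_zero] at hv0
    exact hv0 rfl
  refine ⟨(‖p‖⁻¹ : ℝ) • p, (‖v‖⁻¹ : ℝ) • v, ?_, ?_, ?_, ?_, ?_⟩
  · rw [norm_smul, norm_inv, norm_norm, inv_mul_cancel₀ hp0]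
  · rw [norm_smul, norm_inv, norm_norm, inv_mul_cancel₀ hv0]
  · rw [ContinuousLinearMap.map_smul_of_tower, hp, hE.apply_of_le le_rfl]
  · rw [ContinuousLinearMap.map_smul_of_tower, hv, hE.apply_of_le le_rfl]
  · have h1 : ⟪v, X p⟫_ℂ = ⟪v, v⟫_ℂ := by
      conv_rhs => rw [hv]
      rw [← hE.symm, hv, hE.apply_of_le le_rfl]
    have h2 : ‖⟪v, X p⟫_ℂ‖ = ‖v‖ ^ 2 := by
      rw [h1, inner_self_eq_norm_sq_to_K, norm_pow, RCLike.norm_ofReal, abs_norm]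
    rw [ContinuousLinearMap.map_smul_of_tower, inner_smul_left_eq_smul, inner_smul_right_eq_smul,
      norm_smul, norm_smul, h2, norm_inv, norm_inv, norm_norm, norm_norm]
    calc δ < ‖v‖ := hyX'
      _ ≤ ‖p‖⁻¹ * ‖v‖ := le_mul_of_one_le_left (norm_nonneg v)
          ((one_le_inv₀ ((norm_nonneg p).lt_of_ne' hp0)).2 hp1)
      _ = ‖v‖⁻¹ * (‖p‖⁻¹ * ‖v‖ ^ 2) := by field_simp

end DecreasingProjections

/-! ### Interlaced sequences of vectors -/

section Blocks

variable {H : Type u} [NormedAddCommGroup H] [InnerProductSpace ℂ H]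
  {ι : Type u} [LinearOrder ι] {E : ι → H →L[ℂ] H}

/-- A vector `x` supported between two projections of the net `E`, and vectors `z`, `w` supported
between the second projection and a third one. -/
structure SupportedBlock (E : ι → H →L[ℂ] H) where
  level : ℕ
  fst : ι
  snd : ι
  trd : ι
  x : H
  z : H
  w : H
  fst_le_snd : fst ≤ snd
  snd_le_trd : snd ≤ trd
  norm_x : ‖x‖ = 1
  norm_z : ‖z‖ = 1
  norm_w : ‖w‖ = 1
  fst_x : E fst x = x
  snd_x : E snd x = 0
  snd_z : E snd z = z
  snd_w : E snd w = w
  trd_z : E trd z = 0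
  trd_w : E trd w = 0

/-- The filter provides a vector almost killed by the first operators, and the lower bound on `X`
provides a large matrix entry beyond its truncation. All these conditions are open, so they survive
truncation. -/
lemma IsVanishingProjectionNet.exists_supportedBlock [Nonempty ι]
    (hE : IsVanishingProjectionNet E)
    {G : ℕ → H →L[ℂ] H} (hG : (vanishingFilter E (range G)).NeBot) {X : H →L[ℂ] H} {δ : ℝ}
    (hδ : 0 < δ) (hX : ∀ i, δ < ‖E i * X * E i‖) (k : ℕ) (i : ι) :
    ∃ b : SupportedBlock E, b.level = k ∧ b.fst = i ∧ δ < ‖⟪b.w, X b.z⟫_ℂ‖ ∧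
      ∀ l ≤ k, ‖G l b.x‖ < (1 / 4) ^ k := by
  have hev : ∀ᶠ y in vanishingFilter E (range G), ∀ l ∈ Finset.range (k + 1),
      ‖G l y‖ < (1 / 4) ^ k := by
    refine (Finset.eventually_all _).2 fun l _ => ?_
    have := (tendsto_vanishingFilter (E := E) (mem_range_self (f := G) l)).norm
    rw [norm_zero] at this
    exact this.eventually_lt_const (by positivity)
  obtain ⟨y, hyG, hy1, hyi⟩ := (hev.and (eventually_vanishingFilter (range G) i)).exists
  have htr : ∀ᶠ a in atTop, ∀ l ∈ Finset.range (k + 1), ‖G l (truncation E y a)‖ < (1 / 4) ^ k :=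
    (Finset.eventually_all _).2 fun l hl =>
      (((G l).continuous.tendsto y).comp (hE.tendsto_truncation hy1)).norm.eventually_lt_const
        (hyG l hl)
  obtain ⟨a, haG, hia, hx1, hxi, hxa⟩ := (htr.and (hE.eventually_truncation hy1 hyi)).exists
  obtain ⟨z, w, hz1, hw1, hza, hwa, hzw⟩ := hE.exists_inner_gt hδ (hX a)
  have hin : ∀ᶠ c in atTop, δ < ‖⟪truncation E w c, X (truncation E z c)⟫_ℂ‖ :=
    ((hE.tendsto_truncation hw1).inner
      ((X.continuous.tendsto z).comp (hE.tendsto_truncation hz1))).norm.eventually_const_lt hzw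
  obtain ⟨c, hc, ⟨hac, hz1', hza', hzc⟩, -, hw1', hwa', hwc⟩ :=
    (hin.and ((hE.eventually_truncation hz1 hza).and (hE.eventually_truncation hw1 hwa))).exists
  exact ⟨⟨k, i, a, c, _, _, _, hia, hac, hx1, hz1', hw1', hxi, hxa, hza', hwa', hzc, hwc⟩, rfl, rfl,
    hc, fun l hl => haG l (Finset.mem_range_succ_iff.2 hl)⟩

lemma IsVanishingProjectionNet.exists_seq_supportedBlock [CompleteSpace H] [Nonempty ι]
    (hE : IsVanishingProjectionNet E)
    {G : ℕ → H →L[ℂ] H} (hG : (vanishingFilter E (range G)).NeBot) {X : H →L[ℂ] H} {δ : ℝ}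
    (hδ : 0 < δ) (hX : ∀ i, δ < ‖E i * X * E i‖) (d : ℕ → ι) :
    ∃ b : ℕ → SupportedBlock E, (∀ m n, m < n → (b m).trd ≤ (b n).fst) ∧
      (∀ l n, l ≤ n → d l ≤ (b n).fst) ∧
      (∀ n, δ < ‖⟪(b n).w, X (b n).z⟫_ℂ‖) ∧ (∀ l n, l ≤ n → ‖G l (b n).x‖ ≤ (1 / 4) ^ n) ∧
      ∀ m n, m < n → ‖⟪(b m).w, X (b n).z⟫_ℂ‖ ≤ (1 / 4) ^ n ∧
        ‖⟪(b n).w, X (b m).z⟫_ℂ‖ ≤ (1 / 4) ^ n := by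
  classical
  -- The selection principle sees only the finite set of earlier blocks, not the index; `level`
  -- carries the precision and increases strictly.
  obtain ⟨b, hP, hr⟩ := exists_seq_of_forall_finset_exists
    (fun p : SupportedBlock E => δ < ‖⟪p.w, X p.z⟫_ℂ‖ ∧
      ∀ l ≤ p.level, ‖G l p.x‖ < (1 / 4) ^ p.level ∧ d l ≤ p.fst)
    (fun p q => p.level < q.level ∧ p.trd ≤ q.fst ∧ ‖⟪p.w, X q.z⟫_ℂ‖ ≤ (1 / 4) ^ q.level ∧
      ‖⟪q.w, X p.z⟫_ℂ‖ ≤ (1 / 4) ^ q.level) (by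
    intro s _
    obtain ⟨k, hk⟩ : ∃ k, ∀ p ∈ s, p.level < k :=
      ⟨s.sup SupportedBlock.level + 1, fun p hp =>
        Nat.lt_succ_of_le (Finset.le_sup (f := SupportedBlock.level) hp)⟩
    have hev : ∀ᶠ i in atTop, ∀ p ∈ s, p.trd ≤ i ∧ ‖E i (X p.z)‖ < (1 / 4) ^ k ∧
        ‖E i (X.adjoint p.w)‖ < (1 / 4) ^ k := by
      have h0 : ∀ y, ∀ᶠ i in atTop, ‖E i y‖ < (1 / 4) ^ k := fun y => by
        have := (hE.tendsto y).norm
        rw [norm_zero] at this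
        exact this.eventually_lt_const (by positivity)
      exact (Finset.eventually_all _).2 fun p _ =>
        (eventually_ge_atTop p.trd).and ((h0 _).and (h0 _))
    have hevd : ∀ᶠ i in atTop, ∀ l ∈ Finset.range (k + 1), d l ≤ i :=
      (Finset.eventually_all _).2 fun l _ => eventually_ge_atTop (d l)
    obtain ⟨i, hi, hid⟩ := (hev.and hevd).exists
    obtain ⟨q, rfl, rfl, hq1, hq2⟩ := hE.exists_supportedBlock hG hδ hX k i
    refine ⟨q, ⟨hq1, fun l hl => ⟨hq2 l hl, hid l (Finset.mem_range_succ_iff.2 hl)⟩⟩,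
      fun p hp => ⟨hk p hp, (hi p hp).1, ?_, ?_⟩⟩
    -- Moving `X`, and then the projection, to the earlier vector bounds the entry by the norm of a
    -- vector `E i y` with `y` fixed, which is small for large `i`.
    · rw [← ContinuousLinearMap.adjoint_inner_left,
        ← hE.apply_eq_self_of_le q.fst_le_snd q.snd_z, ← hE.symm]
      refine (norm_inner_le_norm _ _).trans ?_
      rw [q.norm_z, mul_one]
      exact (hi p hp).2.2.le
    · rw [← hE.apply_eq_self_of_le q.fst_le_snd q.snd_w, hE.symm]
      refine (norm_inner_le_norm _ _).trans ?_
      rw [q.norm_w, one_mul]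
      exact (hi p hp).2.1.le)
  have hlev : ∀ n, n ≤ (b n).level := by
    have : StrictMono fun n => (b n).level := fun m n h => (hr m n h).1
    exact fun n => this.le_apply
  have hpow : ∀ n, (1 / 4 : ℝ) ^ (b n).level ≤ (1 / 4) ^ n := fun n =>
    pow_le_pow_of_le_one (by norm_num) (by norm_num) (hlev n)
  exact ⟨b, fun m n h => (hr m n h).2.1, fun l n h => ((hP n).2 l (h.trans (hlev n))).2,
    fun n => (hP n).1, fun l n h => ((hP n).2 l (h.trans (hlev n))).1.le.trans (hpow n),
    fun m n h => ⟨(hr m n h).2.2.1.trans (hpow n), (hr m n h).2.2.2.trans (hpow n)⟩⟩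

lemma IsVanishingProjectionNet.orthonormal (hE : IsVanishingProjectionNet E) {v : ℕ → H}
    {a b : ℕ → ι} (hab : ∀ m n, m < n → b m ≤ a n) (h1 : ∀ n, ‖v n‖ = 1)
    (ha : ∀ n, E (a n) (v n) = v n) (hb : ∀ n, E (b n) (v n) = 0) : Orthonormal ℂ v := by
  have key : ∀ m n, m < n → ⟪v m, v n⟫_ℂ = 0 := fun m n h =>
    hE.inner_eq_zero (hb m) (hE.apply_eq_self_of_le (hab m n h) (ha n))
  refine ⟨h1, fun m n hmn => ?_⟩
  rcases hmn.lt_or_gt with h | h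
  · exact key m n h
  · rw [inner_eq_zero_symm]
    exact key n m h

end Blocks

/-! ### Compressing an operator to an approximate shift -/

section ApproximateShift

variable {H : Type u} [NormedAddCommGroup H] [InnerProductSpace ℂ H] [CompleteSpace H]

/-- If the matrix entries of `X` with respect to orthonormal sequences `w`, `z` are almost
diagonal, then `B * X * A`, with suitable infinite sums `A`, `B` of operators of rank one, almost
maps `x (s j)` to `x (t j)`. -/
lemma exists_mul_mul_approx {x z w : ℕ → H} (hx : Orthonormal ℂ x) (hz : Orthonormal ℂ z)
    (hw : Orthonormal ℂ w) {X : H →L[ℂ] H} {δ : ℝ} (hδ : 0 < δ)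
    (hdiag : ∀ n, δ < ‖⟪w n, X (z n)⟫_ℂ‖)
    (hoff : ∀ m n, m < n → ‖⟪w m, X (z n)⟫_ℂ‖ ≤ (1 / 4) ^ n ∧
      ‖⟪w n, X (z m)⟫_ℂ‖ ≤ (1 / 4) ^ n)
    {s t : ℕ → ℕ} (hs : Function.Injective s) (ht : Function.Injective t) :
    ∃ (A B : H →L[ℂ] H) (c : ℕ → ℂ),
      (∀ y, HasSum (fun k => (1 * ⟪x (s k), y⟫_ℂ) • z k) (A y)) ∧
      (∀ y, HasSum (fun k => (c k * ⟪w k, y⟫_ℂ) • x (t k)) (B y)) ∧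
      ∀ j, ‖(B * X * A) (x (s j)) - x (t j)‖ ≤ δ⁻¹ * 2 * (1 / 2) ^ j := by
  have hne : ∀ n, ⟪w n, X (z n)⟫_ℂ ≠ 0 := fun n => norm_pos_iff.1 (hδ.trans (hdiag n))
  obtain ⟨A, hA⟩ := (hx.comp s hs).exists_clm_hasSum hz (c := fun _ => 1) (K := 1) (by simp)
  have hcle : ∀ k, ‖(⟪w k, X (z k)⟫_ℂ)⁻¹‖ ≤ δ⁻¹ := fun k => by
    rw [norm_inv]
    exact inv_anti₀ hδ (hdiag k).le
  obtain ⟨B, hB⟩ := hw.exists_clm_hasSum (hx.comp t ht) hcle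
  refine ⟨A, B, _, hA, hB, fun j => ?_⟩
  -- Hence `B * X * A` sends `x (s j)` to `B (X (z j))`, whose `j`-th term is exactly `x (t j)`, as
  -- `c j` inverts the diagonal entry. Only the off-diagonal terms remain.
  have hAj : A (x (s j)) = z j := by
    refine (hA (x (s j))).unique ?_
    convert hasSum_ite_eq j (z j) using 2 with k
    have := (orthonormal_iff_ite.1 hx) (s k) (s j)
    simp only [Function.comp_apply, this, hs.eq_iff]
    split_ifs with h
    · simp [h]
    · simp
  have h1 := (hB (X (z j))).sub (hasSum_ite_eq j (x (t j)))
  have h2 : (B * X * A) (x (s j)) = B (X (z j)) := by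
    rw [mul_apply_eq_comp, hAj, mul_apply_eq_comp]
  rw [h2]
  have hg : HasSum (fun k : ℕ => δ⁻¹ * (1 / 2) ^ j * (1 / 2 : ℝ) ^ k) (δ⁻¹ * (1 / 2) ^ j * 2) :=
    hasSum_geometric_two.mul_left _
  refine (h1.norm_le_of_bounded hg fun k => ?_).trans_eq (by ring)
  by_cases hkj : k = j
  · subst hkj
    rw [if_pos rfl, inv_mul_cancel₀ (hne k), one_smul, Function.comp_apply, sub_self, norm_zero]
    positivity
  · rw [if_neg hkj, sub_zero, norm_smul, norm_mul, Function.comp_apply, hx.1, mul_one, mul_assoc]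
    refine mul_le_mul (hcle k) ?_ (norm_nonneg _) (by positivity)
    -- An entry bounded by `(1 / 4) ^ max m n` is bounded by a product of powers of `1 / 2`, which
    -- is summable in one index and still decays in the other.
    have h4 : ∀ m n : ℕ, m < n → (1 / 4 : ℝ) ^ n ≤ (1 / 2) ^ m * (1 / 2) ^ n := by
      intro m n h
      rw [← pow_add, show (1 / 4 : ℝ) = (1 / 2) ^ 2 by norm_num, ← pow_mul]
      exact pow_le_pow_of_le_one (by norm_num) (by norm_num) (by omega)
    rcases lt_or_gt_of_ne hkj with h | h
    · exact ((hoff k j h).1.trans (h4 k j h)).trans_eq (mul_comm _ _)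
    · exact (hoff j k h).2.trans (h4 j k h)

end ApproximateShift

/-! ### Enlarging a countable set of vanishing operators -/

namespace HilbertNest

variable {H : Type u} [NormedAddCommGroup H] [InnerProductSpace ℂ H]

/-- The nest separates `v` from `u`: the operator `⟪u, ·⟫ v` is in the nest algebra. -/
def Separates (𝒩 : HilbertNest H) (u v : H) : Prop :=
  ∃ N ∈ 𝒩.carrier, v ∈ N ∧ ∀ y ∈ N, ⟪u, y⟫_ℂ = 0

/-- A member of the nest lies below the separating one, where the functional is zero, or above it,
and then contains `v`. -/
lemma Separates.inner_smul_mem {𝒩 : HilbertNest H} {u v : H} (h : 𝒩.Separates u v)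
    {M : ClosedSubmodule ℂ H} (hM : M ∈ 𝒩.carrier) {y : H} (hy : y ∈ M) (c : ℂ) :
    (c * ⟪u, y⟫_ℂ) • v ∈ M := by
  obtain ⟨N, hN, hv, hu⟩ := h
  rcases 𝒩.chain.total hM hN with hle | hle
  · rw [hu y (hle hy), mul_zero, zero_smul]
    exact zero_mem M
  · exact M.toSubmodule.smul_mem _ (hle hv)

lemma mem_algebra_of_hasSum {𝒩 : HilbertNest H} {u v : ℕ → H} {c : ℕ → ℂ} {C : H →L[ℂ] H}
    (hC : ∀ y, HasSum (fun k => (c k * ⟪u k, y⟫_ℂ) • v k) (C y))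
    (h : ∀ k, 𝒩.Separates (u k) (v k)) : C ∈ 𝒩.algebra := by
  intro M hM y hy
  refine M.isClosed.mem_of_tendsto (hC y) (Eventually.of_forall fun s => ?_)
  exact M.toSubmodule.sum_mem fun k _ => (h k).inner_smul_mem hM hy (c k)

variable [CompleteSpace H]

/-- The key step: a countable set of operators which vanish along unit vectors supported far down
the net can be enlarged by `1 - B * X * A` for suitable `A` and `B` in the nest algebra. -/
lemma exists_vanishingFilter_insert_neBot (𝒩 : HilbertNest H) {ι : Type u} [LinearOrder ι]
    [Nonempty ι] {E : ι → H →L[ℂ] H} (hE : IsVanishingProjectionNet E)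
    (hsep : (∀ i x y, E i x = 0 → E i y = y → (∃ j, E j x = x) → 𝒩.Separates x y) ∨
      (∀ i x y, E i x = 0 → E i y = y → (∃ j, E j x = x) → 𝒩.Separates y x))
    {S : Set (H →L[ℂ] H)} (hS : S.Countable) (hSE : (vanishingFilter E S).NeBot)
    {X : H →L[ℂ] H} {δ : ℝ} (hδ : 0 < δ) (hX : ∀ i, δ < ‖E i * X * E i‖)
    {d : ℕ → ι} (hd : ∀ i, ∃ n, i ≤ d n) :
    ∃ A ∈ 𝒩.algebra, ∃ B ∈ 𝒩.algebra,
      (vanishingFilter E (insert (1 - B * X * A) S)).NeBot := by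
  -- Adding `0` makes the set nonempty, hence the range of a sequence, and does not change the
  -- filter.
  obtain ⟨G, hG⟩ : ∃ G : ℕ → H →L[ℂ] H, range G = insert 0 S :=
    (hS.insert 0).exists_eq_range (insert_nonempty 0 S) |>.imp fun _ h => h.symm
  have hGE : (vanishingFilter E (range G)).NeBot := by
    have h : vanishingFilter E (range G) = vanishingFilter E S := by
      refine le_antisymm (vanishingFilter_anti (hG ▸ subset_insert 0 S)) ?_
      rw [hG, vanishingFilter, vanishingFilter, iInf_insert]
      exact inf_le_inf_left _ (le_inf (le_top.trans_eq
        (comap_const_of_mem fun t ht => mem_of_mem_nhds ht).symm) le_rfl)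
    rwa [h]
  obtain ⟨b, hb, hbd, hdiag, hGb, hoff⟩ := hE.exists_seq_supportedBlock hGE hδ hX d
  have hx : Orthonormal ℂ fun n => (b n).x := hE.orthonormal (a := fun n => (b n).fst)
    (b := fun n => (b n).snd) (fun m n h => (b m).snd_le_trd.trans (hb m n h))
    (fun n => (b n).norm_x) (fun n => (b n).fst_x) fun n => (b n).snd_x
  have hz : Orthonormal ℂ fun n => (b n).z := hE.orthonormal (a := fun n => (b n).snd)
    (b := fun n => (b n).trd) (fun m n h => (hb m n h).trans (b n).fst_le_snd)
    (fun n => (b n).norm_z) (fun n => (b n).snd_z) fun n => (b n).trd_z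
  have hw : Orthonormal ℂ fun n => (b n).w := hE.orthonormal (a := fun n => (b n).snd)
    (b := fun n => (b n).trd) (fun m n h => (hb m n h).trans (b n).fst_le_snd)
    (fun n => (b n).norm_w) (fun n => (b n).snd_w) fun n => (b n).trd_w
  have hnext : ∀ n, E (b n).trd (b (n + 1)).x = (b (n + 1)).x := fun n =>
    hE.apply_eq_self_of_le (hb n (n + 1) n.lt_succ_self) (b (n + 1)).fst_x
  -- The two cases are the forward shift `x k ↦ z k`, `w k ↦ x (k + 1)` and the backward shift `x (k
  -- + 1) ↦ z k`, `w k ↦ x k`; the direction in which the nest separates vectors decides which one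
  -- is in the algebra.
  have main : ∀ s t : ℕ → ℕ, (s = id ∧ t = Nat.succ) ∨ (s = Nat.succ ∧ t = id) →
      (∀ k, 𝒩.Separates (b (s k)).x (b k).z) → (∀ k, 𝒩.Separates (b k).w (b (t k)).x) →
      ∃ A ∈ 𝒩.algebra, ∃ B ∈ 𝒩.algebra,
        (vanishingFilter E (insert (1 - B * X * A) S)).NeBot := by
    intro s t hst hA' hB'
    have hs : Function.Injective s := by
      rcases hst with ⟨rfl, -⟩ | ⟨rfl, -⟩
      exacts [Function.injective_id, Nat.succ_injective]
    have ht : Function.Injective t := by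
      rcases hst with ⟨-, rfl⟩ | ⟨-, rfl⟩
      exacts [Nat.succ_injective, Function.injective_id]
    have hsle : ∀ j, j ≤ s j := by
      rcases hst with ⟨rfl, -⟩ | ⟨rfl, -⟩
      exacts [fun j => le_rfl, fun j => j.le_succ]
    obtain ⟨A, B, c, hA, hB, hAB⟩ := exists_mul_mul_approx hx hz hw hδ hdiag hoff hs ht
    refine ⟨A, mem_algebra_of_hasSum hA hA', B, mem_algebra_of_hasSum hB hB', ?_⟩
    refine vanishingFilter_neBot_of_tendsto
      (x := fun n => blockMean ((fun n => (b n).x) ∘ s) n)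
      (fun n => (hx.comp s hs).norm_blockMean n) (fun i => ?_) ?_
    · obtain ⟨l, hl⟩ := hd i
      filter_upwards [eventually_ge_atTop l] with n hn
      rw [map_blockMean, blockMean, blockMean]
      congr 1
      refine Finset.sum_congr rfl fun j _ => ?_
      exact hE.apply_eq_self_of_le
        (hl.trans (hbd l _ ((hn.trans (n.le_add_right j)).trans (hsle _))))
        (b _).fst_x
    · rintro D (rfl | hD)
      · exact tendsto_one_sub_blockMean (fun j => (hx.1 j).le) hst hAB
      · obtain ⟨l, rfl⟩ : D ∈ range G := hG ▸ mem_insert_of_mem 0 hD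
        simp only [map_blockMean]
        refine tendsto_blockMean_of_norm_le (K := 1) ?_
        filter_upwards [eventually_ge_atTop l] with j hj
        refine (hGb l (s j) (hj.trans (hsle j))).trans ?_
        rw [one_mul]
        calc (1 / 4 : ℝ) ^ s j ≤ (1 / 4) ^ j :=
              pow_le_pow_of_le_one (by norm_num) (by norm_num) (hsle j)
          _ ≤ (1 / 2) ^ j := by gcongr; norm_num
  rcases hsep with hsep | hsep
  · refine main id Nat.succ (Or.inl ⟨rfl, rfl⟩) (fun k => ?_) fun k => ?_
    · exact hsep (b k).snd _ _ (b k).snd_x (b k).snd_z ⟨_, (b k).fst_x⟩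
    · exact hsep (b k).trd _ _ (b k).trd_w (hnext k) ⟨_, (b k).snd_w⟩
  · refine main Nat.succ id (Or.inr ⟨rfl, rfl⟩) (fun k => ?_) fun k => ?_
    · exact hsep (b k).trd _ _ (b k).trd_z (hnext k) ⟨_, (b k).snd_z⟩
    · exact hsep (b k).snd _ _ (b k).snd_x (b k).snd_w ⟨_, (b k).fst_x⟩

end HilbertNest

/-! ### Countable cofinality from separability -/

section Cofinal

variable {H : Type u} [NormedAddCommGroup H] [InnerProductSpace ℂ H]
  {ι : Type u} [LinearOrder ι] {E : ι → H →L[ℂ] H}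

/-- Choose `d n` such that `E (d n)` is small on the first `n + 1` vectors of a dense sequence. An
index above all `d n` would have a projection vanishing on a dense set. -/
lemma IsVanishingProjectionNet.exists_cofinal_seq [Nonempty ι] [TopologicalSpace.SeparableSpace H]
    (hE : IsVanishingProjectionNet E) (hne : ∀ i, E i ≠ 0) :
    ∃ d : ℕ → ι, ∀ i, ∃ n, i ≤ d n := by
  let D := TopologicalSpace.denseSeq H
  have hD : DenseRange D := TopologicalSpace.denseRange_denseSeq H
  have h : ∀ n : ℕ, ∃ i, ∀ m ∈ Finset.range (n + 1), ‖E i (D m)‖ < (1 / 2) ^ n := by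
    intro n
    refine Eventually.exists (f := atTop) ((Finset.eventually_all _).2 fun m _ => ?_)
    have := (hE.tendsto (D m)).norm
    rw [norm_zero] at this
    exact this.eventually_lt_const (by positivity)
  choose d hd using h
  refine ⟨d, fun i => ?_⟩
  by_contra! hi
  refine hne i (ContinuousLinearMap.coeFn_injective
    (hD.equalizer (E i).continuous continuous_const (funext fun m => ?_)))
  refine tendsto_nhds_unique (f := fun _ : ℕ => E i (D m)) (l := atTop) tendsto_const_nhds
    (squeeze_zero_norm' ?_
      (tendsto_pow_atTop_nhds_zero_of_lt_one (r := (1 / 2 : ℝ)) (by norm_num) (by norm_num)))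
  filter_upwards [eventually_ge_atTop m] with n hn
  rw [← hE.apply_of_ge (hi n).le]
  exact (hE.norm_apply_le i _).trans (hd n m (Finset.mem_range_succ_iff.2 hn)).le

end Cofinal

/-! ### Primitivity from a net, and from a gap in the nest -/

namespace HilbertNest

variable {H : Type u} [NormedAddCommGroup H] [InnerProductSpace ℂ H]

/-- The left ideal of those elements of the nest algebra which tend to `0` along a filter. -/
def tendstoZeroIdeal (𝒩 : HilbertNest H) (F : Filter H) : Ideal 𝒩.algebra where
  carrier := {Y | Tendsto (fun x => (Y : H →L[ℂ] H) x) F (𝓝 0)}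
  zero_mem' := tendsto_const_nhds
  add_mem' := fun {Y Z} hY hZ => by
    have := Tendsto.add hY hZ
    rw [add_zero] at this
    exact this
  smul_mem' := fun C Y hY => by
    have := ((C : H →L[ℂ] H).continuous.tendsto 0).comp hY
    rw [map_zero] at this
    exact this

variable [CompleteSpace H]

/-- A two-sided ideal of the nest algebra which is given by a vanishing net of projections is left
primitive, if the algebra has at most `ℵ₁` elements. -/
theorem isLeftPrimitiveIdeal_of_net {𝒩 : HilbertNest H} [TopologicalSpace.SeparableSpace H]
    (hcard : Cardinal.mk 𝒩.algebra ≤ Cardinal.aleph 1)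
    {ι : Type u} [LinearOrder ι] [Nonempty ι] {E : ι → H →L[ℂ] H}
    (hE : IsVanishingProjectionNet E) (hne : ∀ i, E i ≠ 0)
    (hsep : (∀ i x y, E i x = 0 → E i y = y → (∃ j, E j x = x) → 𝒩.Separates x y) ∨
      (∀ i x y, E i x = 0 → E i y = y → (∃ j, E j x = x) → 𝒩.Separates y x))
    {I : Ideal 𝒩.algebra} [I.IsTwoSided]
    (hI : ∀ X, X ∈ I ↔ ∀ ε > 0, ∃ i, ‖E i * (X : H →L[ℂ] H) * E i‖ < ε) :
    IsLeftPrimitiveIdeal I := by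
  obtain ⟨d, hd⟩ := hE.exists_cofinal_seq hne
  obtain ⟨S, hSE, hS⟩ := exists_set_of_countable_extension
    (α := {X : 𝒩.algebra // X ∉ I}) (β := H →L[ℂ] H) ((Cardinal.mk_subtype_le _).trans hcard)
    (Q := fun S => (vanishingFilter E S).NeBot)
    (R := fun X D => ∃ A ∈ 𝒩.algebra, ∃ B ∈ 𝒩.algebra, 1 - B * (X.1 : H →L[ℂ] H) * A = D)
    (fun S T h hT => hT.mono (vanishingFilter_anti h)) (vanishingFilter_empty_neBot hE hne)
    (fun S h => vanishingFilter_neBot_of_finite h) (by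
      rintro S hSc hSE ⟨X, hX⟩
      rw [hI] at hX
      push Not at hX
      obtain ⟨ε, hε, hX⟩ := hX
      obtain ⟨A, hA, B, hB, h⟩ := 𝒩.exists_vanishingFilter_insert_neBot hE hsep hSc hSE
        (half_pos hε) (fun i => (half_lt_self hε).trans_le (hX i)) hd
      exact ⟨_, ⟨A, hA, B, hB, rfl⟩, h⟩)
  refine isLeftPrimitiveIdeal_of_le (L := 𝒩.tendstoZeroIdeal (vanishingFilter E S) ⊔ I)
    le_sup_right ?_ fun X hX => ?_
  -- If `1 = Y + Z`, a unit vector `x` of the filter with `E i x = x` equals `E i (Y x) + (E i * Z *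
  -- E i) x`, and both terms have norm less than `1 / 2`.
  · intro htop
    obtain ⟨Y, hY, Z, hZ, hYZ⟩ := Submodule.mem_sup.1
      (htop ▸ Submodule.mem_top :
        (1 : 𝒩.algebra) ∈ 𝒩.tendstoZeroIdeal (vanishingFilter E S) ⊔ I)
    obtain ⟨i, hi⟩ := (hI Z).1 hZ (1 / 2) (by norm_num)
    have hY' : Tendsto (fun x => (Y : H →L[ℂ] H) x) (vanishingFilter E S) (𝓝 0) := hY
    have hYn := hY'.norm
    rw [norm_zero] at hYn
    obtain ⟨x, hx, hx1, hxi⟩ := ((hYn.eventually_lt_const (one_half_pos (α := ℝ))).and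
      (eventually_vanishingFilter S i)).exists
    have h1 : (Y : H →L[ℂ] H) x + (Z : H →L[ℂ] H) x = x :=
      congrArg (fun W : 𝒩.algebra => (W : H →L[ℂ] H) x) hYZ
    have h2 : E i ((Y : H →L[ℂ] H) x) + (E i * (Z : H →L[ℂ] H) * E i) x = x := by
      rw [mul_apply_eq_comp, mul_apply_eq_comp, hxi, ← map_add, h1, hxi]
    have h3 := norm_add_le (E i ((Y : H →L[ℂ] H) x)) ((E i * (Z : H →L[ℂ] H) * E i) x)
    have h4 := hE.norm_apply_le i ((Y : H →L[ℂ] H) x)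
    have h5 := (E i * (Z : H →L[ℂ] H) * E i).le_opNorm x
    rw [h2, hx1] at h3
    rw [hx1, mul_one] at h5
    linarith
  · obtain ⟨D, hD, A, hA, B, hB, rfl⟩ := hS ⟨X, hX⟩
    exact ⟨⟨A, hA⟩, ⟨B, hB⟩, Submodule.mem_sup_left (tendsto_vanishingFilter hD)⟩

section IntervalProj

variable {A B : ClosedSubmodule ℂ H}

lemma intervalProj_apply_mem (h : A ≤ B) (x : H) : intervalProj A B x ∈ B :=
  B.toSubmodule.sub_mem (Submodule.starProjection_apply_mem B.toSubmodule x)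
    (h (Submodule.starProjection_apply_mem A.toSubmodule x))

lemma intervalProj_symm (A B : ClosedSubmodule ℂ H) (x y : H) :
    ⟪intervalProj A B x, y⟫_ℂ = ⟪x, intervalProj A B y⟫_ℂ := by
  simp only [intervalProj, sub_apply, inner_sub_left, inner_sub_right,
    Submodule.inner_starProjection_left_eq_right]

lemma intervalProj_apply_of_mem_left (h : A ≤ B) {x : H} (hx : x ∈ A) :
    intervalProj A B x = 0 := by
  rw [intervalProj, sub_apply, Submodule.starProjection_eq_self_iff.2 hx,
    Submodule.starProjection_eq_self_iff.2 (h hx), sub_self]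

lemma mem_left_of_intervalProj_eq_zero {x : H} (hx : x ∈ B) (h : intervalProj A B x = 0) :
    x ∈ A := by
  rw [intervalProj, sub_apply, Submodule.starProjection_eq_self_iff.2 hx, sub_eq_zero] at h
  exact Submodule.starProjection_eq_self_iff.1 h.symm

lemma inner_eq_zero_of_intervalProj_eq_self (h : A ≤ B) {x y : H} (hx : intervalProj A B x = x)
    (hy : y ∈ A) : ⟪x, y⟫_ℂ = 0 := by
  rw [← hx, intervalProj_symm, intervalProj_apply_of_mem_left h hy, inner_zero_right]

lemma intervalProj_mul_self (h : A ≤ B) :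
    intervalProj A B * intervalProj A B = intervalProj A B := by
  simp only [intervalProj, sub_mul, mul_sub, proj_mul_self, proj_mul_of_le h, mul_proj_of_le h]
  abel

lemma intervalProj_ne_zero (h : A < B) : intervalProj A B ≠ 0 := fun h0 =>
  h.not_ge fun x hx => mem_left_of_intervalProj_eq_zero hx (by rw [h0]; rfl)

end IntervalProj

/-- No member of the nest lies strictly between `M` and `N`, so every rank-one operator from the
atom into `N` is in the algebra. For a nonzero `x` in the atom, `L` consists of the operators
sending `x` into `M`. -/
lemma isLeftPrimitiveIdeal_of_gap {𝒩 : HilbertNest H} {M N : ClosedSubmodule ℂ H}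
    (hM : M ∈ 𝒩.carrier) (hN : N ∈ 𝒩.carrier) (hlt : M < N)
    (hgap : ∀ C ∈ 𝒩.carrier, C ≤ M ∨ N ≤ C) {I : Ideal 𝒩.algebra} [I.IsTwoSided]
    (hI : ∀ X, X ∈ I ↔ compress M N (X : H →L[ℂ] H) = 0) : IsLeftPrimitiveIdeal I := by
  set E := intervalProj M N with hE
  have hEE : ∀ y, E (E y) = E y := fun y =>
    congrArg (fun C : H →L[ℂ] H => C y) (intervalProj_mul_self hlt.le)
  have hrank : ∀ u v : H, E u = u → v ∈ N → (innerSL ℂ u).smulRight v ∈ 𝒩.algebra := by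
    intro u v hu hv C hC y hy
    rw [ContinuousLinearMap.smulRight_apply, innerSL_apply_apply]
    rcases hgap C hC with h | h
    · rw [inner_eq_zero_of_intervalProj_eq_self hlt.le hu (h hy), zero_smul]
      exact zero_mem C
    · exact C.toSubmodule.smul_mem _ (h hv)
  obtain ⟨y, hy⟩ : ∃ y, E y ≠ 0 := by
    by_contra! h
    exact intervalProj_ne_zero hlt (ContinuousLinearMap.ext h)
  set x := E y with hx
  let L : Ideal 𝒩.algebra :=
    { carrier := {Y | (Y : H →L[ℂ] H) x ∈ M}
      zero_mem' := zero_mem M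
      add_mem' := fun hY hZ => add_mem (S := ClosedSubmodule ℂ H) hY hZ
      smul_mem' := fun C Y hY => C.2 M hM _ hY }
  have hxx : ⟪x, x⟫_ℂ ≠ 0 := inner_self_ne_zero.2 hy
  refine isLeftPrimitiveIdeal_of_le (L := L) (fun X hX => ?_) (fun htop => ?_) fun X hX => ?_
  · refine mem_left_of_intervalProj_eq_zero (B := N)
      (X.2 N hN _ (intervalProj_apply_mem hlt.le y)) ?_
    exact congrArg (fun C : H →L[ℂ] H => C y) ((hI X).1 hX)
  · have h1 : x ∈ M := (htop ▸ Submodule.mem_top : (1 : 𝒩.algebra) ∈ L)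
    exact hxx (inner_eq_zero_of_intervalProj_eq_self hlt.le (hEE y) h1)
  · obtain ⟨q, hq⟩ : ∃ q, E ((X : H →L[ℂ] H) (E q)) ≠ 0 := by
      by_contra! h
      exact hX ((hI X).2 (ContinuousLinearMap.ext h))
    set v := E ((X : H →L[ℂ] H) (E q)) with hv
    have hvv : ⟪v, v⟫_ℂ ≠ 0 := inner_self_ne_zero.2 hq
    -- `A` sends `x` to `E q`, and `B` sends `X (E q)`, whose component in the atom is `v`, back to
    -- `x`; thus `1 - B * X * A` kills `x`.
    refine ⟨⟨_, hrank x ((⟪x, x⟫_ℂ)⁻¹ • E q) (hEE y)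
        (N.toSubmodule.smul_mem _ (intervalProj_apply_mem hlt.le q))⟩,
      ⟨_, hrank v ((⟪v, v⟫_ℂ)⁻¹ • x) (hEE _)
        (N.toSubmodule.smul_mem _ (intervalProj_apply_mem hlt.le y))⟩, ?_⟩
    have hvX : ⟪v, (X : H →L[ℂ] H) (E q)⟫_ℂ = ⟪v, v⟫_ℂ := by
      conv_rhs => rw [hv]
      rw [hE, ← intervalProj_symm, ← hE, hv, hEE]
    have key : x - (innerSL ℂ v).smulRight ((⟪v, v⟫_ℂ)⁻¹ • x)
        ((X : H →L[ℂ] H) ((innerSL ℂ x).smulRight ((⟪x, x⟫_ℂ)⁻¹ • E q) x)) = 0 := by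
      simp only [ContinuousLinearMap.smulRight_apply, innerSL_apply_apply, smul_smul,
        mul_inv_cancel₀ hxx, one_smul, hvX, mul_inv_cancel₀ hvv, sub_self]
    have h0 : (0 : H) ∈ M := zero_mem M
    rw [← key] at h0
    exact h0

end HilbertNest

/-! ### Strong limits of monotone nets of projections -/

section StrongConvergence

variable {H : Type u} [NormedAddCommGroup H] [InnerProductSpace ℂ H] [CompleteSpace H]
  {ι : Type u} [Preorder ι]

lemma ClosedSubmodule.tendsto_starProjection_iSup {U : ι → ClosedSubmodule ℂ H} (hU : Monotone U)
    (x : H) : Tendsto (fun i => (U i).toSubmodule.starProjection x) atTop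
      (𝓝 ((⨆ i, U i).toSubmodule.starProjection x)) := by
  have h := Submodule.starProjection_tendsto_closure_iSup (fun i => (U i).toSubmodule)
    (fun _ _ h => hU h) x
  convert h using 3
  congr 1
  exact ClosedSubmodule.toSubmodule_iSup U

lemma ClosedSubmodule.tendsto_starProjection_iInf {U : ι → ClosedSubmodule ℂ H} (hU : Antitone U)
    (x : H) : Tendsto (fun i => (U i).toSubmodule.starProjection x) atTop
      (𝓝 ((⨅ i, U i).toSubmodule.starProjection x)) := by
  have hperp : ∀ V : ClosedSubmodule ℂ H, V.toSubmodule.starProjection x =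
      x - Vᗮ.toSubmodule.starProjection x := fun V => by
    have h : Vᗮ.toSubmodule.starProjection = 1 - V.toSubmodule.starProjection :=
      Submodule.starProjection_orthogonal' V.toSubmodule
    rw [h, sub_apply, one_apply_eq_self, sub_sub_cancel]
  have h1 : (⨅ i, U i)ᗮ = ⨆ i, (U i)ᗮ := by
    have := ClosedSubmodule.iInf_orthogonal fun i => (U i)ᗮ
    simp only [ClosedSubmodule.orthogonal_orthogonal_eq] at this
    rw [this, ClosedSubmodule.orthogonal_orthogonal_eq]
  have h2 := ClosedSubmodule.tendsto_starProjection_iSup (U := fun i => (U i)ᗮ)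
    (fun i j h => ClosedSubmodule.orthogonal_le (hU h)) x
  rw [← h1] at h2
  rw [hperp]
  exact (h2.const_sub x).congr fun i => (hperp _).symm

end StrongConvergence

/-! ### Primitivity of the diagonal ideals -/

namespace HilbertNest

variable {H : Type u} [NormedAddCommGroup H] [InnerProductSpace ℂ H]

/-- The linear order of a part of the nest. -/
noncomputable abbrev linearOrderSubtype (𝒩 : HilbertNest H) (p : ClosedSubmodule ℂ H → Prop) :
    LinearOrder {M : ClosedSubmodule ℂ H // M ∈ 𝒩.carrier ∧ p M} :=
  { (inferInstance : PartialOrder {M : ClosedSubmodule ℂ H // M ∈ 𝒩.carrier ∧ p M}) with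
    le_total := fun A B => 𝒩.chain.total A.2.1 B.2.1
    toDecidableLE := Classical.decRel _ }

lemma mk_algebra_le_aleph_one (continuumHypothesis : Cardinal.aleph.{0} 1 = Cardinal.continuum.{0})
    [TopologicalSpace.SeparableSpace H] (𝒩 : HilbertNest H) :
    Cardinal.mk 𝒩.algebra ≤ Cardinal.aleph 1 := by
  -- The hypothesis is stated in universe `0`, and lifting transports it.
  have h : Cardinal.aleph.{u} 1 = Cardinal.continuum.{u} := by
    have := congrArg Cardinal.lift.{u} continuumHypothesis
    simpa using this
  rw [h]
  exact (Cardinal.mk_subtype_le _).trans mk_continuousLinearMap_le_continuum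

variable [CompleteSpace H]

lemma intervalProj_mul_intervalProj {A A' B B' : ClosedSubmodule ℂ H} (h1 : A ≤ A') (h2 : A' ≤ B')
    (h3 : B' ≤ B) : intervalProj A B * intervalProj A' B' = intervalProj A' B' := by
  simp only [intervalProj, sub_mul, mul_sub, mul_proj_of_le h3, mul_proj_of_le (h2.trans h3),
    proj_mul_of_le (h1.trans h2), proj_mul_of_le h1]
  abel

theorem isLeftPrimitiveIdeal_upperIdeal {𝒩 : HilbertNest H} [TopologicalSpace.SeparableSpace H]
    (hcard : Cardinal.mk 𝒩.algebra ≤ Cardinal.aleph 1) {N : ClosedSubmodule ℂ H}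
    (hN : N ∈ 𝒩.carrier) (hlt : N < ⊤) : IsLeftPrimitiveIdeal (𝒩.upperIdeal N hN hlt) := by
  have : (𝒩.upperIdeal N hN hlt).IsTwoSided := 𝒩.upperIdeal_isTwoSided N hN hlt
  have hmem : ∀ X, X ∈ 𝒩.upperIdeal N hN hlt ↔
      ∀ ε > 0, ∃ M ∈ 𝒩.carrier, N < M ∧ ‖compress N M (X : H →L[ℂ] H)‖ < ε := fun X =>
    𝒩.upperSeminorm_eq_zero_iff hlt X
  set T := {M : ClosedSubmodule ℂ H | M ∈ 𝒩.carrier ∧ N < M}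
  have hTc : sInf T ∈ 𝒩.carrier := 𝒩.sInf_mem T fun M hM => hM.1
  have hNT : N ≤ sInf T := le_sInf fun M hM => hM.2.le
  -- Either `sInf T` is the immediate successor of `N`, or the members above `N` decrease to `N`.
  rcases hNT.lt_or_eq with hgap | hnogap
  · refine isLeftPrimitiveIdeal_of_gap hN hTc hgap (fun C hC => ?_) fun X => ?_
    · rcases 𝒩.chain.total hC hN with h | h
      · exact Or.inl h
      · rcases h.lt_or_eq with h | h
        · exact Or.inr (sInf_le ⟨hC, h⟩)
        · exact Or.inl h.ge
    · rw [hmem]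
      constructor
      · intro h
        refine norm_le_zero_iff.1 (le_of_forall_pos_lt_add fun ε hε => ?_)
        obtain ⟨M, hM, hNM, hl⟩ := h ε hε
        rw [zero_add]
        exact (norm_compress_mono le_rfl hNT (sInf_le ⟨hM, hNM⟩) _).trans_lt hl
      · intro h ε hε
        exact ⟨_, hTc, hgap, by rwa [h, norm_zero]⟩
  · let _ : LinearOrder {M : ClosedSubmodule ℂ H // M ∈ 𝒩.carrier ∧ N < M} :=
      𝒩.linearOrderSubtype (N < ·)
    -- The order is reversed so that the intervals shrink along `atTop`.
    let ι := {M : ClosedSubmodule ℂ H // M ∈ 𝒩.carrier ∧ N < M}ᵒᵈ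
    have : Nonempty ι := ⟨OrderDual.toDual ⟨⊤, 𝒩.top_mem, hlt⟩⟩
    let U : ι → ClosedSubmodule ℂ H := fun i => (OrderDual.ofDual i).1
    have hU : ∀ i, U i ∈ 𝒩.carrier ∧ N < U i := fun i => (OrderDual.ofDual i).2
    have hUanti : Antitone U := fun i j h => h
    have hUinf : ⨅ i, U i = N := by
      rw [hnogap]
      refine le_antisymm (le_sInf fun M hM => iInf_le U (OrderDual.toDual ⟨M, hM⟩))
        (le_iInf fun i => sInf_le (hU i))
    refine isLeftPrimitiveIdeal_of_net hcard (E := fun i : ι => intervalProj N (U i))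
      ⟨fun i => intervalProj_symm N (U i), fun {i j} h x => ?_, fun x => ?_⟩
      (fun i => intervalProj_ne_zero (hU i).2) (Or.inl ?_) fun X => ?_
    · exact congrArg (fun C : H →L[ℂ] H => C x)
        (intervalProj_mul_intervalProj le_rfl (hU j).2.le (hUanti h))
    · have := (ClosedSubmodule.tendsto_starProjection_iInf hUanti x).sub_const
        (N.toSubmodule.starProjection x)
      rwa [hUinf, sub_self] at this
    · rintro i x y hx hy ⟨j, hj⟩
      refine ⟨U i, (hU i).1, hy ▸ intervalProj_apply_mem (hU i).2.le y, fun v hv => ?_⟩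
      -- A vector in the range of some `E j` is orthogonal to `N`, so `E i x = 0` makes it
      -- orthogonal to all of `U i`.
      have h1 : N.toSubmodule.starProjection x = 0 := by
        rw [← hj]
        have : N.toSubmodule.starProjection * intervalProj N (U j) = 0 := by
          rw [intervalProj, mul_sub, proj_mul_of_le (hU j).2.le, proj_mul_self, sub_self]
        exact congrArg (fun C : H →L[ℂ] H => C x) this
      have h2 : (U i).toSubmodule.starProjection x = 0 := by
        have hx' : (U i).toSubmodule.starProjection x - N.toSubmodule.starProjection x = 0 := hx
        rwa [h1, sub_zero] at hx'
      rw [← Submodule.starProjection_eq_self_iff.2 (show v ∈ (U i).toSubmodule from hv),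
        ← Submodule.inner_starProjection_left_eq_right, h2, inner_zero_left]
    · rw [hmem]
      refine forall₂_congr fun ε _ => ⟨?_, ?_⟩
      · rintro ⟨M, hM, hNM, hl⟩
        exact ⟨OrderDual.toDual ⟨M, hM, hNM⟩, hl⟩
      · rintro ⟨i, hi⟩
        exact ⟨U i, (hU i).1, (hU i).2, hi⟩

theorem isLeftPrimitiveIdeal_lowerIdeal {𝒩 : HilbertNest H} [TopologicalSpace.SeparableSpace H]
    (hcard : Cardinal.mk 𝒩.algebra ≤ Cardinal.aleph 1) {N : ClosedSubmodule ℂ H}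
    (hN : N ∈ 𝒩.carrier) (hlt : ⊥ < N) : IsLeftPrimitiveIdeal (𝒩.lowerIdeal N hN hlt) := by
  have : (𝒩.lowerIdeal N hN hlt).IsTwoSided := 𝒩.lowerIdeal_isTwoSided N hN hlt
  have hmem : ∀ X, X ∈ 𝒩.lowerIdeal N hN hlt ↔
      ∀ ε > 0, ∃ M ∈ 𝒩.carrier, M < N ∧ ‖compress M N (X : H →L[ℂ] H)‖ < ε := fun X =>
    𝒩.lowerSeminorm_eq_zero_iff hlt X
  set T := {M : ClosedSubmodule ℂ H | M ∈ 𝒩.carrier ∧ M < N}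
  have hTc : sSup T ∈ 𝒩.carrier := 𝒩.sSup_mem T fun M hM => hM.1
  have hNT : sSup T ≤ N := sSup_le fun M hM => hM.2.le
  rcases hNT.lt_or_eq with hgap | hnogap
  · refine isLeftPrimitiveIdeal_of_gap hTc hN hgap (fun C hC => ?_) fun X => ?_
    · rcases 𝒩.chain.total hC hN with h | h
      · rcases h.lt_or_eq with h | h
        · exact Or.inl (le_sSup ⟨hC, h⟩)
        · exact Or.inr h.ge
      · exact Or.inr h
    · rw [hmem]
      constructor
      · intro h
        refine norm_le_zero_iff.1 (le_of_forall_pos_lt_add fun ε hε => ?_)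
        obtain ⟨M, hM, hNM, hl⟩ := h ε hε
        rw [zero_add]
        exact (norm_compress_mono (le_sSup (show M ∈ T from ⟨hM, hNM⟩)) hNT le_rfl _).trans_lt hl
      · intro h ε hε
        exact ⟨_, hTc, hgap, by rwa [h, norm_zero]⟩
  · let _ : LinearOrder {M : ClosedSubmodule ℂ H // M ∈ 𝒩.carrier ∧ M < N} :=
      𝒩.linearOrderSubtype (· < N)
    let ι := {M : ClosedSubmodule ℂ H // M ∈ 𝒩.carrier ∧ M < N}
    have : Nonempty ι := ⟨⟨⊥, 𝒩.bot_mem, hlt⟩⟩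
    let U : ι → ClosedSubmodule ℂ H := Subtype.val
    have hU : ∀ i, U i ∈ 𝒩.carrier ∧ U i < N := fun i => i.2
    have hUmono : Monotone U := fun i j h => h
    have hUsup : ⨆ i, U i = N := by
      rw [← hnogap]
      exact le_antisymm (iSup_le fun i => le_sSup (hU i))
        (sSup_le fun M hM => le_iSup U ⟨M, hM⟩)
    -- Here later vectors are orthogonal to larger members of the nest, so the separation is
    -- reversed and the backward shift is used.
    refine isLeftPrimitiveIdeal_of_net hcard (E := fun i : ι => intervalProj (U i) N)
      ⟨fun i => intervalProj_symm (U i) N, fun {i j} h x => ?_, fun x => ?_⟩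
      (fun i => intervalProj_ne_zero (hU i).2) (Or.inr ?_) fun X => ?_
    · exact congrArg (fun C : H →L[ℂ] H => C x)
        (intervalProj_mul_intervalProj (hUmono h) (hU j).2.le le_rfl)
    · have := (ClosedSubmodule.tendsto_starProjection_iSup hUmono x).const_sub
        (N.toSubmodule.starProjection x)
      rwa [hUsup, sub_self] at this
    · rintro i x y hx hy ⟨j, hj⟩
      exact ⟨U i, (hU i).1, mem_left_of_intervalProj_eq_zero
        (hj ▸ intervalProj_apply_mem (hU j).2.le x) hx,
        fun v hv => inner_eq_zero_of_intervalProj_eq_self (hU i).2.le hy hv⟩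
    · rw [hmem]
      refine forall₂_congr fun ε _ => ⟨?_, ?_⟩
      · rintro ⟨M, hM, hNM, hl⟩
        exact ⟨⟨M, hM, hNM⟩, hl⟩
      · rintro ⟨i, hi⟩
        exact ⟨U i, (hU i).1, (hU i).2, hi⟩

/-! ### Ringrose's criterion for the radical -/

section Radical

variable {𝒩 : HilbertNest H}

lemma starProjection_mem_algebra {M : ClosedSubmodule ℂ H} (hM : M ∈ 𝒩.carrier) :
    M.toSubmodule.starProjection ∈ 𝒩.algebra := by
  intro C hC x hx
  rcases 𝒩.chain.total hC hM with h | h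
  · rwa [Submodule.starProjection_eq_self_iff.2 (h hx)]
  · exact h (Submodule.starProjection_apply_mem M.toSubmodule x)

lemma mul_starProjection_of_mem_algebra {X : H →L[ℂ] H} (hX : X ∈ 𝒩.algebra)
    {M : ClosedSubmodule ℂ H} (hM : M ∈ 𝒩.carrier) :
    M.toSubmodule.starProjection * (X * M.toSubmodule.starProjection) =
      X * M.toSubmodule.starProjection := by
  ext x
  exact Submodule.starProjection_eq_self_iff.2
    (hX M hM _ (Submodule.starProjection_apply_mem M.toSubmodule x))

lemma tsum_pow_mem_algebra {c : H →L[ℂ] H} (hc : c ∈ 𝒩.algebra) (hc1 : ‖c‖ < 1) :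
    ∑' n : ℕ, c ^ n ∈ 𝒩.algebra := by
  intro C hC x hx
  have h := ((summable_geometric_of_norm_lt_one hc1).hasSum).mapL
    (ContinuousLinearMap.apply ℂ H x)
  refine C.isClosed.mem_of_tendsto h (Eventually.of_forall fun s => ?_)
  exact C.toSubmodule.sum_mem fun n _ => (pow_mem hc n) C hC x hx

/-- Left invertibility of `1 - X` on `M` extends to `N ≥ M` if the compression of `X` to the
interval between `M` and `N` has norm less than one. -/
lemma exists_left_inverse_on_of_norm_compress_lt {X : H →L[ℂ] H} (hX : X ∈ 𝒩.algebra)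
    {M N : ClosedSubmodule ℂ H} (hM : M ∈ 𝒩.carrier) (hN : N ∈ 𝒩.carrier) (hle : M ≤ N)
    (hnorm : ‖compress M N X‖ < 1) {Y : H →L[ℂ] H} (hY : Y ∈ 𝒩.algebra)
    (hYX : Y * (1 - X) * M.toSubmodule.starProjection = M.toSubmodule.starProjection) :
    ∃ Y' ∈ 𝒩.algebra,
      Y' * (1 - X) * N.toSubmodule.starProjection = N.toSubmodule.starProjection := by
  set P := M.toSubmodule.starProjection with hP
  set Q := N.toSubmodule.starProjection with hQ
  set c := compress M N X with hc
  set E := intervalProj M N with hE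
  set U := 1 - X with hU
  have hPm : P ∈ 𝒩.algebra := starProjection_mem_algebra hM
  have hQm : Q ∈ 𝒩.algebra := starProjection_mem_algebra hN
  have hEm : E ∈ 𝒩.algebra := sub_mem hQm hPm
  have hUm : U ∈ 𝒩.algebra := sub_mem (one_mem _) hX
  have hcm : c ∈ 𝒩.algebra := mul_mem (mul_mem hEm hX) hEm
  -- The Neumann series inverts `1 - c`, and so inverts the compression of `U` to the interval.
  set W := ∑' n : ℕ, c ^ n with hW
  have hWm : W ∈ 𝒩.algebra := tsum_pow_mem_algebra hcm hnorm
  have hW1 : W * (1 - c) = 1 := geom_series_mul_neg c hnorm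
  have hW2 : (1 - c) * W = 1 := mul_neg_geom_series c hnorm
  have hEE : E * E = E := intervalProj_mul_self hle
  have hcE : c * E = c := by rw [hc, compress, ← hE, mul_assoc, hEE]
  have hEc : E * c = c := by rw [hc, compress, ← hE, ← mul_assoc, ← mul_assoc, hEE]
  have hEW : E * W = W * E := by
    calc E * W = W * (1 - c) * E * W := by rw [hW1, one_mul]
      _ = W * (E * (1 - c)) * W := by
          rw [mul_assoc W, sub_mul, mul_sub E, one_mul, mul_one, hcE, hEc]
      _ = W * E := by rw [mul_assoc, mul_assoc E, hW2, mul_one]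
  have hEP : E * P = 0 := by
    rw [hE, intervalProj, sub_mul, ← hP, mul_proj_of_le hle, proj_mul_self, sub_self]
  have hQE : Q * E = E := by
    rw [hE, intervalProj, mul_sub, proj_mul_self, mul_proj_of_le hle]
  have hUP : P * (U * P) = U * P := mul_starProjection_of_mem_algebra hUm hM
  have hUQ : Q * (U * Q) = U * Q := mul_starProjection_of_mem_algebra hUm hN
  have hQPE : Q = P + E := by rw [hE, intervalProj, ← hP, ← hQ, add_sub_cancel]
  have h1 : E * W * U * P = 0 := by
    rw [hEW, mul_assoc, mul_assoc, ← hUP, ← mul_assoc E, hEP, zero_mul, mul_zero]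
  have h2 : E * W * U * E = E := by
    have : E * (U * E) = (1 - c) * E := by
      rw [hU, sub_mul, mul_sub, one_mul, hEE, sub_mul, one_mul, hcE, hc, compress, ← hE, mul_assoc]
    rw [hEW, mul_assoc, mul_assoc, this, ← mul_assoc, hW1, one_mul]
  have h3 : Y * P * U * P = P := by rw [mul_assoc, mul_assoc, hUP, ← mul_assoc, hYX]
  -- With respect to `Q = P + E` the operator `U` is upper triangular. This is the usual left
  -- inverse of a triangular 2×2 block matrix, built from the left inverses of its diagonal blocks.
  refine ⟨Y * P + (1 - Y * P * U) * (E * W), add_mem (mul_mem hY hPm)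
    (mul_mem (sub_mem (one_mem _) (mul_mem (mul_mem hY hPm) hUm)) (mul_mem hEm hWm)), ?_⟩
  have h4 : (Y * P + (1 - Y * P * U) * (E * W)) * U * P = P := by
    calc _ = Y * P * U * P + (1 - Y * P * U) * (E * W * U * P) := by
          simp only [add_mul, mul_assoc]
      _ = P := by rw [h1, h3, mul_zero, add_zero]
  have h5 : (Y * P + (1 - Y * P * U) * (E * W)) * U * E = E := by
    calc _ = Y * P * U * E + (1 - Y * P * U) * (E * W * U * E) := by
          simp only [add_mul, mul_assoc]
      _ = E := by rw [h2, sub_mul, one_mul, add_sub_cancel]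
  rw [hQPE, mul_add, h4, h5]

/-- Ringrose's criterion: an element of all diagonal ideals is left quasi-regular. -/
lemma exists_left_inverse_one_sub {X : 𝒩.algebra} (hX : ∀ I, 𝒩.IsDiagonalIdeal I → X ∈ I) :
    ∃ Y : 𝒩.algebra, Y * (1 - X) = 1 := by
  set S := {M : ClosedSubmodule ℂ H | M ∈ 𝒩.carrier ∧ ∃ Y ∈ 𝒩.algebra,
    Y * (1 - (X : H →L[ℂ] H)) * M.toSubmodule.starProjection = M.toSubmodule.starProjection}
    with hS
  have hext : ∀ M ∈ S, ∀ N ∈ 𝒩.carrier, M ≤ N → ‖compress M N (X : H →L[ℂ] H)‖ < 1 → N ∈ S := by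
    rintro M ⟨hM, Y, hY, hYX⟩ N hN hle hnorm
    exact ⟨hN, exists_left_inverse_on_of_norm_compress_lt X.2 hM hN hle hnorm hY hYX⟩
  have hbot : ⊥ ∈ S := by
    refine ⟨𝒩.bot_mem, 0, zero_mem _, ?_⟩
    have : (⊥ : ClosedSubmodule ℂ H).toSubmodule.starProjection = 0 := Submodule.starProjection_bot
    rw [this, mul_zero]
  have hsup : sSup S ∈ 𝒩.carrier := 𝒩.sSup_mem S fun M hM => hM.1
  -- The lower seminorm at `sSup S` vanishes, so some interval just below it has a small
  -- compression. It contains the interval from some `M' ∈ S` to `sSup S`, and invertibility extends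
  -- from `M'`.
  have hsupS : sSup S ∈ S := by
    rcases (bot_le (a := sSup S)).lt_or_eq with h | h
    · obtain ⟨M, hM, hlt, hl⟩ := (𝒩.lowerSeminorm_eq_zero_iff h X).1
        (hX _ (Or.inr ⟨_, hsup, h, rfl⟩)) 1 one_pos
      obtain ⟨M', hM', hMM'⟩ : ∃ M' ∈ S, ¬ M' ≤ M := by
        by_contra! hall
        exact hlt.not_ge (sSup_le hall)
      have hle : M ≤ M' := (𝒩.chain.total hM hM'.1).resolve_right hMM'
      exact hext M' hM' _ hsup (le_sSup hM')
        ((norm_compress_mono hle (le_sSup hM') le_rfl _).trans_lt hl)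
    · exact h ▸ hbot
  -- Below `⊤`, the vanishing upper seminorm would extend invertibility strictly past the supremum.
  have htop : sSup S = ⊤ := by
    by_contra hne
    have h : sSup S < ⊤ := lt_top_iff_ne_top.2 hne
    obtain ⟨M, hM, hlt, hl⟩ := (𝒩.upperSeminorm_eq_zero_iff h X).1
      (hX _ (Or.inl ⟨_, hsup, h, rfl⟩)) 1 one_pos
    exact hlt.not_ge (le_sSup (hext _ hsupS M hM hlt.le hl))
  rw [htop] at hsupS
  obtain ⟨-, Y, hY, hYX⟩ := hsupS
  have h1 : (⊤ : ClosedSubmodule ℂ H).toSubmodule.starProjection = 1 := Submodule.starProjection_top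
  rw [h1, mul_one] at hYX
  exact ⟨⟨Y, hY⟩, Subtype.ext hYX⟩

end Radical

end HilbertNest

theorem mainTheorem1 (continuumHypothesis : Cardinal.aleph.{0} 1 = Cardinal.continuum.{0})
    {H : Type u} [NormedAddCommGroup H] [InnerProductSpace ℂ H] [CompleteSpace H]
    [TopologicalSpace.SeparableSpace H] (𝒩 : HilbertNest H) :
    (∀ I : Ideal 𝒩.algebra, 𝒩.IsDiagonalIdeal I → IsLeftPrimitiveIdeal I) ∧
      Ring.jacobson 𝒩.algebra = sInf {I : Ideal 𝒩.algebra | 𝒩.IsDiagonalIdeal I} := by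
  have hcard := HilbertNest.mk_algebra_le_aleph_one continuumHypothesis 𝒩
  have hprim : ∀ I : Ideal 𝒩.algebra, 𝒩.IsDiagonalIdeal I → IsLeftPrimitiveIdeal I := by
    rintro I (⟨N, hN, hlt, rfl⟩ | ⟨N, hN, hlt, rfl⟩)
    · exact HilbertNest.isLeftPrimitiveIdeal_upperIdeal hcard hN hlt
    · exact HilbertNest.isLeftPrimitiveIdeal_lowerIdeal hcard hN hlt
  refine ⟨hprim, le_antisymm (le_sInf fun I hI => (hprim I hI).jacobson_le)
    (le_jacobson_of_left_inverse fun X hX => ?_)⟩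
  exact HilbertNest.exists_left_inverse_one_sub fun I hI => (sInf_le hI : sInf _ ≤ I) hX
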